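/- Let $M$ be a Hausdorff smooth manifold, let $\mathbb F\in\{\mathbb R,\mathbb C\}$, and let $R=C_c^\infty(M)$ be the ring (in general without identity) of smooth $\mathbb F$-valued functions with compact support on $M$. Let $C$ be a coalgebra over $R$, i.e. an $R$-module in which any finitely many elements $c_1,\dots,c_k$ admit $r\in R$ with $rc_i=c_i$ for all $i$, together with $R$-linear maps $\Delta:C\to C\otimes_R C$ and $\epsilon:C\to R$ such that $(\mathrm{id}\otimes\epsilon)\circ\Delta=\mathrm{id}=(\epsilon\otimes\mathrm{id})\circ\Delta$. An element $c\in C$ is weakly grouplike if $\Delta(c)=c\otimes c'$ for some $c'\in C$; the set of these elements is $G_w(C)$. An element $c\in C$ is normalized at $x\in M$ if the germ $\epsilon(c)_x$ equals $1$, and normalized on $W\subset M$ if it is normalized at every point of $W$. For $x\in M$ put $N_x(C)=\{c\in C\mid fc=0\text{ for some }f\in R\text{ with germ }f_x=1\}$ and $C_x=C/N_x(C)$, and write $c_x$ for the class of $c$ in $C_x$. The maps $\Delta$ and $\epsilon$ induce a coalgebra structure $(\Delta_x,\epsilon_x)$ on $C_x$ over the ring $R_x$ of germs at $x$ of smooth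 functions, and $G(C_x)=\{\zeta\in C_x\mid\Delta_x(\zeta)=\zeta\otimes\zeta,\ \epsilon_x(\zeta)=1\}$. The spectral sheaf $\pi:\mathcal E_{sp}(C)\to M$ is the sheaf with stalks $\mathcal E_{sp}(C)_x=G(C_x)$; its topology has as basis the sets $c_W=\{c_x\mid x\in W\}$, where $W\subset M$ is open and $c\in G_w(C)$ is normalized on $W$, and its (not necessarily Hausdorff) smooth structure is the one for which $\pi$ is a local diffeomorphism. For a not necessarily Hausdorff manifold $E$, $C_c^\infty(E)$ denotes the group of finite sums of extensions by zero of smooth functions with compact support on Hausdorff open subsets of $E$, as not necessarily continuous sections of the sheaf of germs of functions on $E$. Let $\Psi_C:C_c^\infty(\mathcal E_{sp}(C))\to C$ be the well-defined map given by $$\Psi_C\Big(\sum_{i=1}^k f_i\circ\pi|_{(c_i)_{W_i}}\Big)=\sum_{i=1}^k f_ic_i ,$$ where $c_i\in G_w(C)$ is normalized on the open set $W_i\subset M$ and $f_i\in C_c^\infty(W_i)$. Let $\Lambda\subset G_w(C)$. Let $\mathcal E_{sp}^\Lambda(C)\subset\mathcal E_{sp}(C)$ be the open subsheaf with stalks $\{c_x\mid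 c\in\Lambda,\ \epsilon(c)_x=1\}$, let $\mathrm{inc}_+:C_c^\infty(\mathcal E_{sp}^\Lambda(C))\to C_c^\infty(\mathcal E_{sp}(C))$ be extension by zero, and let $\Psi_C^\Lambda=\Psi_C\circ\mathrm{inc}_+$. Then: (i) $\Psi_C^\Lambda$ is surjective if and only if $\Lambda$ normally generates $C$, i.e. every $c\in C$ is a finite sum $c=\sum_{i=1}^k f_ic_i$ with $f_i\in R$ and $c_i\in\Lambda$ normalized on $\mathrm{supp}(f_i)$. (ii) $\Psi_C^\Lambda$ is injective if and only if $\Lambda$ is normally linearly independent, i.e. for every $x\in M$, all $c_1,\dots,c_k\in\Lambda$ normalized at $x$ and all $f_1,\dots,f_k\in R$ with $\sum_{i=1}^k f_ic_i=0$, either $(f_i)_x=0$ for all $i$, or there are distinct indices $i,j$ and $f\in R$ with $f_x=1$ and $fc_i=fc_j$. -/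

import Mathlib

open scoped Manifold ContDiff Topology TensorProduct
open Filter

set_option linter.unusedSectionVars false

noncomputable section

namespace SheafCoalg

/-! ### Modules and coalgebras over a commutative ring without identity -/

/-- A (left) module over a commutative ring `R` which need not have an identity. -/
class NUModule (R : Type*) [NonUnitalCommRing R] (C : Type*) [AddCommGroup C]
    extends SMul R C where
  smul_add' : ∀ (r : R) (c d : C), r • (c + d) = r • c + r • d
  add_smul' : ∀ (r s : R) (c : C), (r + s) • c = r • c + s • c
  mul_smul' : ∀ (r s : R) (c : C), (r * s) • c = r • (s • c)

/-- The ring `R` with an identity freely adjoined.  Modules over the non-unital ring `R` are the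
same as unital modules over `Plus R`, with the same submodules, quotients, linear maps and tensor
products (the integers act on any abelian group, and additive maps and tensors are automatically
linear, respectively balanced, over them). -/
def Plus (R : Type*) [NonUnitalCommRing R] : Type _ := Unitization ℤ R

instance plusCommRing (R : Type*) [NonUnitalCommRing R] : CommRing (Plus R) :=
  inferInstanceAs (CommRing (Unitization ℤ R))

/-- The inclusion of `R` into `Plus R`. -/
def ofR {R : Type*} [NonUnitalCommRing R] (r : R) : Plus R := (Unitization.inr r : Unitization ℤ R)

theorem ofR_mul {R : Type*} [NonUnitalCommRing R] (r s : R) : ofR (r * s) = ofR r * ofR s :=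
  Unitization.inr_mul ℤ r s

section Algebra

variable {R : Type*} [NonUnitalCommRing R] {C : Type*} [AddCommGroup C] [NUModule R C]

theorem nu_smul_zero (r : R) : r • (0 : C) = 0 := by
  have h := NUModule.smul_add' r (0 : C) 0
  simpa using h

theorem nu_zero_smul (c : C) : (0 : R) • c = 0 := by
  have h := NUModule.add_smul' (0 : R) 0 c
  simpa using h

/-- The action of `R` on a module, as a biadditive map. -/
def actHom (R : Type*) [NonUnitalCommRing R] (C : Type*) [AddCommGroup C] [NUModule R C] :
    R →+ C →+ C where
  toFun r :=
    { toFun := fun c => r • c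
      map_zero' := nu_smul_zero r
      map_add' := NUModule.smul_add' r }
  map_zero' := by ext c; exact nu_zero_smul c
  map_add' r s := by ext c; exact NUModule.add_smul' r s c

theorem nu_smul_zsmul (r : R) (k : ℤ) (c : C) : r • (k • c) = k • (r • c) :=
  map_zsmul (actHom R C r) k c

theorem nu_zsmul_smul (r : R) (k : ℤ) (c : C) : (k • r) • c = k • (r • c) := by
  have := congrArg (fun φ : C →+ C => φ c) (map_zsmul (actHom R C) k r)
  simpa [actHom] using this

/-- A module over the non-unital ring `R` is a unital module over `Plus R`:
`(k + r) c = k c + r c` for an integer `k` and `r` in `R`. -/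
instance plusModule : Module (Plus R) C where
  smul a c := (Unitization.toProd a).1 • c + (Unitization.toProd a).2 • c
  one_smul c := by
    change (1 : ℤ) • c + (0 : R) • c = c
    rw [nu_zero_smul]; simp
  mul_smul a b c := by
    change ((Unitization.toProd a).1 * (Unitization.toProd b).1) • c + ((Unitization.toProd a).1 • (Unitization.toProd b).2 + (Unitization.toProd b).1 • (Unitization.toProd a).2 + (Unitization.toProd a).2 * (Unitization.toProd b).2) • c
      = (Unitization.toProd a).1 • ((Unitization.toProd b).1 • c + (Unitization.toProd b).2 • c) + (Unitization.toProd a).2 • ((Unitization.toProd b).1 • c + (Unitization.toProd b).2 • c)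
    simp only [NUModule.add_smul', NUModule.mul_smul', NUModule.smul_add', nu_smul_zsmul,
      nu_zsmul_smul, mul_smul, smul_add]
    abel
  smul_zero a := by
    change (Unitization.toProd a).1 • (0 : C) + (Unitization.toProd a).2 • (0 : C) = 0
    rw [nu_smul_zero]; simp
  smul_add a c d := by
    change (Unitization.toProd a).1 • (c + d) + (Unitization.toProd a).2 • (c + d) = ((Unitization.toProd a).1 • c + (Unitization.toProd a).2 • c) + ((Unitization.toProd a).1 • d + (Unitization.toProd a).2 • d)
    rw [NUModule.smul_add', smul_add]; abel
  add_smul a b c := by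
    change ((Unitization.toProd a).1 + (Unitization.toProd b).1) • c + ((Unitization.toProd a).2 + (Unitization.toProd b).2) • c
      = ((Unitization.toProd a).1 • c + (Unitization.toProd a).2 • c) + ((Unitization.toProd b).1 • c + (Unitization.toProd b).2 • c)
    rw [NUModule.add_smul', add_smul]; abel
  zero_smul c := by
    change (0 : ℤ) • c + (0 : R) • c = 0
    rw [nu_zero_smul]; simp

theorem plus_smul_def (a : Plus R) (c : C) :
    a • c = (Unitization.toProd a).1 • c + (Unitization.toProd a).2 • c := rfl

theorem ofR_smul (r : R) (c : C) : ofR r • c = r • c := by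
  rw [plus_smul_def]
  change (0 : ℤ) • c + r • c = r • c
  simp

/-- The ring `R` as a module over itself. -/
instance selfModule (R : Type*) [NonUnitalCommRing R] : NUModule R R where
  smul r s := r * s
  smul_add' := mul_add
  add_smul' := add_mul
  mul_smul' := mul_assoc

/-- The action `R × C → C` as a bilinear map; it induces the natural identification of
`R ⊗ C` with `C`, if `C` is locally unitary. -/
def act (R : Type*) [NonUnitalCommRing R] (C : Type*) [AddCommGroup C] [NUModule R C] :
    R →ₗ[Plus R] C →ₗ[Plus R] C :=
  LinearMap.mk₂ (Plus R) (fun r c => r • c)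
    (fun r s c => NUModule.add_smul' r s c)
    (fun a r c => by
      rw [plus_smul_def, plus_smul_def, NUModule.add_smul', nu_zsmul_smul]
      congr 1
      exact NUModule.mul_smul' ((Unitization.toProd a).2) r c)
    (fun r c d => NUModule.smul_add' r c d)
    (fun a r c => by
      rw [plus_smul_def, plus_smul_def, NUModule.smul_add', nu_smul_zsmul, ← NUModule.mul_smul',
        ← NUModule.mul_smul', mul_comm])

end Algebra

/-- A coalgebra over the commutative ring `R`: a locally unitary `R`-module `C` with `R`-linear maps
`Δ : C → C ⊗ C` and `ε : C → R` such that `(ε ⊗ id) ∘ Δ = id` and `(id ⊗ ε) ∘ Δ = id`.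
Neither coassociativity nor cocommutativity is required. -/
class Coalg (R : Type*) [NonUnitalCommRing R] (C : Type*) [AddCommGroup C] [NUModule R C] where
  locallyUnitary : ∀ s : Finset C, ∃ r : R, ∀ c ∈ s, r • c = c
  comul : C →ₗ[Plus R] C ⊗[Plus R] C
  counit : C →ₗ[Plus R] R
  counit_comul : ∀ c : C, TensorProduct.lift (act R C ∘ₗ counit) (comul c) = c
  comul_counit : ∀ c : C, TensorProduct.lift (act R C ∘ₗ counit).flip (comul c) = c

/-- The weakly grouplike elements: `Δ c = c ⊗ c'` for some `c'`. -/
def weaklyGrouplike (R : Type*) [NonUnitalCommRing R] (C : Type*) [AddCommGroup C] [NUModule R C]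
    [Coalg R C] : Set C :=
  {c | ∃ c' : C, Coalg.comul (R := R) c = c ⊗ₜ[Plus R] c'}

/-! ### Smooth functions with compact support on a Hausdorff manifold -/

/-- `Cc 𝔽 n N` is the ring of smooth `𝔽`-valued functions with compact support on the
(Hausdorff) manifold `N` of dimension `n`. -/
def Cc (𝔽 : Type*) [RCLike 𝔽] (n : ℕ) (N : Type*) [TopologicalSpace N]
    [ChartedSpace (EuclideanSpace ℝ (Fin n)) N] : NonUnitalSubring (N → 𝔽) where
  carrier := {f | ContMDiff (𝓡 n) 𝓘(ℝ, 𝔽) ∞ f ∧ HasCompactSupport f}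
  zero_mem' := ⟨contMDiff_const, HasCompactSupport.zero⟩
  add_mem' hf hg := ⟨hf.1.add hg.1, hf.2.add hg.2⟩
  neg_mem' hf := ⟨hf.1.neg, hf.2.neg⟩
  mul_mem' hf hg := ⟨by
    intro x
    have := (contDiff_mul (𝕜 := ℝ) (𝔸 := 𝔽) (n := ∞)).contMDiff.contMDiffAt.comp x
      ((hf.1 x).prodMk_space (hg.1 x))
    exact this, hf.2.mul_right⟩

section Bump

variable {𝔽 : Type*} [RCLike 𝔽] {n : ℕ} {N : Type*} [TopologicalSpace N]
  [ChartedSpace (EuclideanSpace ℝ (Fin n)) N]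

theorem Cc.add_apply (f g : Cc 𝔽 n N) (x : N) : (f + g : Cc 𝔽 n N).1 x = f.1 x + g.1 x := rfl

theorem Cc.mul_apply (f g : Cc 𝔽 n N) (x : N) : (f * g : Cc 𝔽 n N).1 x = f.1 x * g.1 x := rfl

/-- Bump functions. -/
theorem exists_bump [IsManifold (𝓡 n) ∞ N] [T2Space N] {x : N} {U : Set N} (hU : U ∈ 𝓝 x) :
    ∃ f : Cc 𝔽 n N, f.1 =ᶠ[𝓝 x] 1 ∧ tsupport f.1 ⊆ U := by
  obtain ⟨b, -, hb⟩ := (SmoothBumpFunction.nhds_basis_tsupport (I := 𝓡 n) x).mem_iff.1 hU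
  have hsub : tsupport (fun y => ((b y : ℝ) : 𝔽)) ⊆ tsupport b :=
    closure_mono fun y hy => by
      intro h0
      exact hy (by simp [h0])
  refine ⟨⟨fun y => ((b y : ℝ) : 𝔽), ?_, ?_⟩, ?_, hsub.trans hb⟩
  · have h : ContMDiff 𝓘(ℝ, ℝ) 𝓘(ℝ, 𝔽) ∞ (fun r : ℝ => (r : 𝔽)) :=
      (RCLike.ofRealCLM (K := 𝔽)).contDiff.contMDiff
    exact h.comp b.contMDiff
  · exact b.hasCompactSupport.of_isClosed_subset (isClosed_tsupport _) hsub
  · filter_upwards [b.eventuallyEq_one] with y hy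
    simp [hy]

/-- A property of smooth functions with compact support which is additive and holds for functions
supported near any given point holds for all of them. -/
theorem Cc.induction [IsManifold (𝓡 n) ∞ N] [T2Space N] (P : Cc 𝔽 n N → Prop)
    (h0 : P 0) (hadd : ∀ f g, P f → P g → P (f + g))
    (hloc : ∀ x : N, ∃ V ∈ 𝓝 x, ∀ f, tsupport f.1 ⊆ V → P f) (f : Cc 𝔽 n N) : P f := by
  have key : ∃ b : Cc 𝔽 n N, (∃ V ∈ 𝓝ˢ (tsupport f.1), ∀ y ∈ V, b.1 y = 1) ∧ ∀ g, P (b * g) := by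
    have hK : IsCompact (tsupport f.1) := f.2.2
    generalize tsupport f.1 = K at hK
    refine hK.induction_on (p := fun K => ∃ b : Cc 𝔽 n N,
      (∃ V ∈ 𝓝ˢ K, ∀ y ∈ V, b.1 y = 1) ∧ ∀ g, P (b * g)) ?_ ?_ ?_ ?_
    · exact ⟨0, ⟨∅, by simp, by simp⟩, fun g => by simpa using h0⟩
    · rintro s t hst ⟨b, ⟨V, hV, h1⟩, h2⟩
      exact ⟨b, ⟨V, nhdsSet_mono hst hV, h1⟩, h2⟩
    · rintro s t ⟨b, ⟨V, hV, h1⟩, h2⟩ ⟨b', ⟨V', hV', h1'⟩, h2'⟩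
      refine ⟨b + b' - b' * b, ⟨V ∪ V', ?_, ?_⟩, fun g => ?_⟩
      · rw [nhdsSet_union]
        exact ⟨mem_of_superset hV Set.subset_union_left,
          mem_of_superset hV' Set.subset_union_right⟩
      · intro y hy
        change b.1 y + b'.1 y - b'.1 y * b.1 y = 1
        rcases hy with hy | hy
        · rw [h1 y hy]; ring
        · rw [h1' y hy]; ring
      · have : (b + b' - b' * b) * g = b * g + b' * (g - b * g) := by
          simp only [mul_sub, sub_mul, add_mul, mul_assoc]; abel
        rw [this]
        exact hadd _ _ (h2 g) (h2' _)
    · intro x _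
      obtain ⟨V, hV, hP⟩ := hloc x
      obtain ⟨b, hb1, hb2⟩ := exists_bump (𝔽 := 𝔽) (n := n) hV
      obtain ⟨W, hW, hWo, hxW⟩ := mem_nhds_iff.1 hb1
      refine ⟨W, mem_nhdsWithin_of_mem_nhds (hWo.mem_nhds hxW), b,
        ⟨W, hWo.mem_nhdsSet.2 subset_rfl, fun y hy => hW hy⟩, fun g => hP _ ?_⟩
      exact (tsupport_mul_subset_left (f := b.1) (g := g.1)).trans hb2
  obtain ⟨b, ⟨V, hV, h1⟩, h2⟩ := key
  have : b * f = f := by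
    ext y
    change b.1 y * f.1 y = f.1 y
    by_cases hy : y ∈ tsupport f.1
    · rw [h1 y (subset_of_mem_nhdsSet hV hy), one_mul]
    · rw [image_eq_zero_of_notMem_tsupport hy, mul_zero]
  rw [← this]
  exact h2 f

end Bump

/-! ### Sheaves: the smooth structure on the total space of a local homeomorphism -/

section LocalHomeo

variable {n : ℕ} {M : Type*} [TopologicalSpace M] [ChartedSpace (EuclideanSpace ℝ (Fin n)) M]
  {E : Type*} [TopologicalSpace E] {p : E → M}

/-- A local inverse datum of the local homeomorphism `p` near the point `y`. -/
def localHomeo (hp : IsLocalHomeomorph p) (y : E) : OpenPartialHomeomorph E M := (hp y).choose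

theorem mem_localHomeo (hp : IsLocalHomeomorph p) (y : E) : y ∈ (localHomeo hp y).source :=
  (hp y).choose_spec.1

theorem localHomeo_eq (hp : IsLocalHomeomorph p) (y : E) : ⇑(localHomeo hp y) = p :=
  (hp y).choose_spec.2.symm

/-- The total space of a local homeomorphism `p` over a manifold: the charts are the restrictions
of `p` to open sets on which it is injective, followed by charts of the base. -/
@[reducible] def etaleChartedSpace (n : ℕ) [ChartedSpace (EuclideanSpace ℝ (Fin n)) M]
    (hp : IsLocalHomeomorph p) :
    ChartedSpace (EuclideanSpace ℝ (Fin n)) E where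
  atlas := {e | ∃ y : E, e = (localHomeo hp y).trans
    (chartAt (EuclideanSpace ℝ (Fin n)) (p y))}
  chartAt y := (localHomeo hp y).trans (chartAt (EuclideanSpace ℝ (Fin n)) (p y))
  mem_chart_source y := by
    rw [OpenPartialHomeomorph.trans_source]
    refine ⟨mem_localHomeo hp y, ?_⟩
    rw [Set.mem_preimage, localHomeo_eq]
    exact mem_chart_source _ _
  chart_mem_atlas y := ⟨y, rfl⟩

theorem etale_isManifold (hp : IsLocalHomeomorph p) [IsManifold (𝓡 n) ∞ M] :
    let _ := etaleChartedSpace n hp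
    IsManifold (𝓡 n) ∞ E := by
  let _ := etaleChartedSpace n hp
  have : HasGroupoid E (contDiffGroupoid ∞ (𝓡 n)) := by
    refine ⟨?_⟩
    rintro _ _ ⟨y, rfl⟩ ⟨z, rfl⟩
    set e := localHomeo hp y with he
    set e' := localHomeo hp z with he'
    set a := chartAt (EuclideanSpace ℝ (Fin n)) (p y)
    set b := chartAt (EuclideanSpace ℝ (Fin n)) (p z)
    have hab : a.symm.trans b ∈ contDiffGroupoid ∞ (𝓡 n) :=
      (contDiffGroupoid ∞ (𝓡 n)).compatible (chart_mem_atlas _ _) (chart_mem_atlas _ _)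
    have hs : IsOpen ((e.trans a).symm.trans (e'.trans b)).source :=
      OpenPartialHomeomorph.open_source _
    refine (contDiffGroupoid ∞ (𝓡 n)).mem_of_eqOnSource
      (closedUnderRestriction' hab hs) ?_
    constructor
    · rw [OpenPartialHomeomorph.restr_source' _ _ hs]
      refine (Set.inter_eq_right.2 ?_).symm
      intro t ht
      simp only [OpenPartialHomeomorph.trans_source, OpenPartialHomeomorph.symm_source,
        Set.mem_inter_iff, Set.mem_preimage, OpenPartialHomeomorph.coe_trans_symm,
        OpenPartialHomeomorph.trans_target, Function.comp_apply] at ht ⊢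
      have h1 : e' (e.symm (a.symm t)) = a.symm t := by
        rw [localHomeo_eq, ← localHomeo_eq hp y]
        exact e.right_inv ht.1.2
      exact ⟨ht.1.1, by simpa [h1] using ht.2.2⟩
    · intro t ht
      simp only [OpenPartialHomeomorph.trans_source, OpenPartialHomeomorph.symm_source,
        Set.mem_inter_iff, Set.mem_preimage, OpenPartialHomeomorph.coe_trans_symm,
        OpenPartialHomeomorph.trans_target, Function.comp_apply] at ht
      have h1 : e' (e.symm (a.symm t)) = a.symm t := by
        rw [localHomeo_eq, ← localHomeo_eq hp y]
        exact e.right_inv ht.1.2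
      simp [h1]
  exact IsManifold.mk' _ _ _

/-- A function on the total space is smooth near `y` iff it is the pull-back of a smooth function
on the base near `y`. -/
theorem etale_contMDiffAt_iff {𝔽 : Type*} [RCLike 𝔽] (hp : IsLocalHomeomorph p) {g : E → 𝔽}
    {y : E} :
    let _ := etaleChartedSpace n hp
    ContMDiffAt (𝓡 n) 𝓘(ℝ, 𝔽) ∞ g y ↔
      ∃ k : M → 𝔽, ContMDiffAt (𝓡 n) 𝓘(ℝ, 𝔽) ∞ k (p y) ∧ g =ᶠ[𝓝 y] k ∘ p := by
  let _ := etaleChartedSpace n hp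
  set e := localHomeo hp y with he
  have hey : y ∈ e.source := mem_localHomeo hp y
  have hep : ⇑e = p := localHomeo_eq hp y
  have main : ContMDiffAt (𝓡 n) 𝓘(ℝ, 𝔽) ∞ g y ↔
      ContMDiffAt (𝓡 n) 𝓘(ℝ, 𝔽) ∞ (g ∘ e.symm) (p y) := by
    rw [contMDiffAt_iff, contMDiffAt_iff]
    have h1 : ContinuousAt g y ↔ ContinuousAt (g ∘ e.symm) (p y) := by
      rw [← hep]
      constructor
      · intro h
        refine ContinuousAt.comp ?_ (e.continuousAt_symm (e.map_source hey))
        rwa [e.left_inv hey]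
      · intro h
        refine (h.comp (e.continuousAt hey)).congr ?_
        filter_upwards [e.open_source.mem_nhds hey] with z hz
        rw [Function.comp_apply, Function.comp_apply, e.left_inv hz]
    rw [h1]
    refine and_congr Iff.rfl ?_
    have h2 : extChartAt (𝓡 n) y y = extChartAt (𝓡 n) (p y) (p y) := by
      simp only [extChartAt, OpenPartialHomeomorph.extend_coe, Function.comp_apply]
      change (𝓡 n) ((e.trans (chartAt _ (p y))) y) = _
      rw [OpenPartialHomeomorph.coe_trans, Function.comp_apply, hep]
    rw [h2]
    exact Iff.rfl
  refine main.trans ?_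
  constructor
  · intro h
    refine ⟨_, h, ?_⟩
    filter_upwards [e.open_source.mem_nhds hey] with z hz
    rw [Function.comp_apply, Function.comp_apply, ← hep, e.left_inv hz]
  · rintro ⟨k, hk, hgk⟩
    refine hk.congr_of_eventuallyEq ?_
    have ht : Tendsto e.symm (𝓝 (p y)) (𝓝 y) := by
      have := e.tendsto_symm hey
      rwa [hep] at this
    have htar : e.target ∈ 𝓝 (p y) := by
      rw [← hep]; exact e.open_target.mem_nhds (e.map_source hey)
    filter_upwards [ht.eventually hgk, htar] with x hx hxt
    rw [Function.comp_apply, hx, Function.comp_apply, ← hep, e.right_inv hxt]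

end LocalHomeo

/-! ### Localization at a point -/

section Local

variable (𝔽 : Type*) [RCLike 𝔽] (n : ℕ) {M : Type*} [TopologicalSpace M]
  [ChartedSpace (EuclideanSpace ℝ (Fin n)) M] [IsManifold (𝓡 n) ∞ M] [T2Space M]

/-- The submodule `N_x(D)` of those `c` with `f c = 0` for some `f` with germ `1` at `x`. -/
def Nx (x : M) (D : Type*) [AddCommGroup D] [Module (Plus (Cc 𝔽 n M)) D] :
    Submodule (Plus (Cc 𝔽 n M)) D where
  carrier := {c | ∃ f : Cc 𝔽 n M, f.1 =ᶠ[𝓝 x] 1 ∧ ofR f • c = 0}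
  zero_mem' := by
    obtain ⟨f, hf, -⟩ := exists_bump (𝔽 := 𝔽) (n := n) (x := x) univ_mem
    exact ⟨f, hf, smul_zero _⟩
  add_mem' := by
    rintro c d ⟨f, hf, hfc⟩ ⟨g, hg, hgd⟩
    refine ⟨f * g, ?_, ?_⟩
    · filter_upwards [hf, hg] with y h1 h2
      rw [Cc.mul_apply, h1, h2]; simp
    · rw [smul_add, ofR_mul, mul_smul _ _ d, hgd, mul_comm, mul_smul _ _ c, hfc]
      simp
  smul_mem' := by
    rintro a c ⟨f, hf, hfc⟩
    exact ⟨f, hf, by rw [smul_comm, hfc, smul_zero]⟩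

/-- The localization `D_x = D / N_x(D)` of a module at `x`. -/
abbrev Stalk (x : M) (D : Type*) [AddCommGroup D] [Module (Plus (Cc 𝔽 n M)) D] : Type _ :=
  D ⧸ Nx 𝔽 n x D

/-- The class `c_x` of `c` in `D_x`. -/
abbrev toStalk (x : M) {D : Type*} [AddCommGroup D] [Module (Plus (Cc 𝔽 n M)) D] (c : D) :
    Stalk 𝔽 n x D := (Nx 𝔽 n x D).mkQ c

variable {𝔽 n}

theorem toStalk_eq_zero {x : M} {D : Type*} [AddCommGroup D] [Module (Plus (Cc 𝔽 n M)) D]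
    {c : D} : toStalk 𝔽 n x c = 0 ↔ ∃ f : Cc 𝔽 n M, f.1 =ᶠ[𝓝 x] 1 ∧ ofR f • c = 0 :=
  Submodule.Quotient.mk_eq_zero (Nx 𝔽 n x D)

theorem toStalk_smul {x : M} {D : Type*} [AddCommGroup D] [Module (Plus (Cc 𝔽 n M)) D]
    (a : Plus (Cc 𝔽 n M)) (c : D) : toStalk 𝔽 n x (a • c) = a • toStalk 𝔽 n x c := rfl

/-- The action of functions on `D_x` depends only on their germs at `x`. -/
theorem smul_toStalk_zero {x : M} {D : Type*} [AddCommGroup D] [Module (Plus (Cc 𝔽 n M)) D]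
    {f : Cc 𝔽 n M} (hf : f.1 =ᶠ[𝓝 x] 0) (s : Stalk 𝔽 n x D) : ofR f • s = 0 := by
  obtain ⟨c, rfl⟩ := Submodule.mkQ_surjective _ s
  rw [← map_smul]
  refine toStalk_eq_zero.2 ?_
  obtain ⟨p, hp1, hp2⟩ := exists_bump (𝔽 := 𝔽) (n := n) hf
  refine ⟨p, hp1, ?_⟩
  rw [← mul_smul, ← ofR_mul]
  have : p * f = 0 := by
    ext y
    change p.1 y * f.1 y = 0
    by_cases hy : y ∈ tsupport p.1
    · rw [show f.1 y = 0 from hp2 hy, mul_zero]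
    · rw [image_eq_zero_of_notMem_tsupport hy, zero_mul]
  rw [this]
  exact zero_smul (Plus (Cc 𝔽 n M)) c

theorem smul_toStalk_one {x : M} {D : Type*} [AddCommGroup D] [Module (Plus (Cc 𝔽 n M)) D]
    {f : Cc 𝔽 n M} (hf : f.1 =ᶠ[𝓝 x] 1) (s : Stalk 𝔽 n x D) : ofR f • s = s := by
  obtain ⟨c, rfl⟩ := Submodule.mkQ_surjective _ s
  rw [← map_smul, ← sub_eq_zero, ← map_sub]
  refine toStalk_eq_zero.2 ?_
  obtain ⟨p, hp1, hp2⟩ := exists_bump (𝔽 := 𝔽) (n := n) hf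
  refine ⟨p, hp1, ?_⟩
  rw [smul_sub, ← mul_smul, ← ofR_mul]
  have : p * f = p := by
    ext y
    change p.1 y * f.1 y = p.1 y
    by_cases hy : y ∈ tsupport p.1
    · rw [show f.1 y = 1 from hp2 hy, mul_one]
    · rw [image_eq_zero_of_notMem_tsupport hy, zero_mul]
  rw [this, sub_self]

/-- Germs of functions at `x` as a module over the smooth functions with compact support. -/
instance germModule (x : M) : NUModule (Cc 𝔽 n M) (Germ (𝓝 x) 𝔽) where
  smul f g := (f.1 : Germ (𝓝 x) 𝔽) * g
  smul_add' _ _ _ := mul_add _ _ _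
  add_smul' f f' g := add_mul (f.1 : Germ (𝓝 x) 𝔽) (f'.1 : Germ (𝓝 x) 𝔽) g
  mul_smul' f f' g := mul_assoc (f.1 : Germ (𝓝 x) 𝔽) (f'.1 : Germ (𝓝 x) 𝔽) g

/-- The map sending a function to its germ at `x`. -/
def germAt (𝔽 : Type*) [RCLike 𝔽] (n : ℕ) {M : Type*} [TopologicalSpace M]
    [ChartedSpace (EuclideanSpace ℝ (Fin n)) M] (x : M) :
    Cc 𝔽 n M →ₗ[Plus (Cc 𝔽 n M)] Germ (𝓝 x) 𝔽 where
  toFun f := (f.1 : Germ (𝓝 x) 𝔽)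
  map_add' _ _ := rfl
  map_smul' a f := by
    simp only [RingHom.id_apply, plus_smul_def]
    let φ : Cc 𝔽 n M →+ Germ (𝓝 x) 𝔽 :=
      { toFun := fun f => (f.1 : Germ (𝓝 x) 𝔽), map_zero' := rfl, map_add' := fun _ _ => rfl }
    change φ _ = _
    rw [map_add, map_zsmul]
    rfl

variable (𝔽 n) (C : Type*) [AddCommGroup C] [NUModule (Cc 𝔽 n M) C] [Coalg (Cc 𝔽 n M) C]

/-- The projection `C ⊗ C → C_x ⊗ C_x`. -/
def tensorToStalk (x : M) : C ⊗[Plus (Cc 𝔽 n M)] C →ₗ[Plus (Cc 𝔽 n M)]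
    Stalk 𝔽 n x C ⊗[Plus (Cc 𝔽 n M)] Stalk 𝔽 n x C :=
  TensorProduct.map (Nx 𝔽 n x C).mkQ (Nx 𝔽 n x C).mkQ

theorem smul_tensorStalk_one {x : M} {f : Cc 𝔽 n M} (hf : f.1 =ᶠ[𝓝 x] 1)
    (t : Stalk 𝔽 n x C ⊗[Plus (Cc 𝔽 n M)] Stalk 𝔽 n x C) : ofR f • t = t := by
  induction t with
  | zero => simp
  | tmul a b => rw [TensorProduct.smul_tmul', smul_toStalk_one hf]
  | add a b ha hb => rw [smul_add, ha, hb]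

/-- The comultiplication of the local coalgebra `C_x`, induced by that of `C`.  As `Cc 𝔽 n M` acts
on `C_x` through its quotient ring of germs at `x`, the tensor products of `C_x` with itself over
these two rings are the same. -/
def comulAt (x : M) : Stalk 𝔽 n x C →ₗ[Plus (Cc 𝔽 n M)]
    Stalk 𝔽 n x C ⊗[Plus (Cc 𝔽 n M)] Stalk 𝔽 n x C :=
  (Nx 𝔽 n x C).liftQ (tensorToStalk 𝔽 n C x ∘ₗ Coalg.comul) (by
    rintro c ⟨f, hf, hfc⟩
    rw [LinearMap.mem_ker, ← smul_tensorStalk_one 𝔽 n C hf ((tensorToStalk 𝔽 n C x ∘ₗ Coalg.comul) c),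
      ← map_smul, hfc, map_zero])

/-- The counit of the local coalgebra `C_x`, induced by that of `C`, with values in germs. -/
def counitAt (x : M) : Stalk 𝔽 n x C →ₗ[Plus (Cc 𝔽 n M)] Germ (𝓝 x) 𝔽 :=
  (Nx 𝔽 n x C).liftQ (germAt 𝔽 n x ∘ₗ Coalg.counit) (by
    rintro c ⟨f, hf, hfc⟩
    rw [LinearMap.mem_ker]
    have h : (germAt 𝔽 n x ∘ₗ Coalg.counit) (ofR f • c) = 0 := by rw [hfc, map_zero]
    rw [map_smul, ofR_smul] at h
    have h1 : (f.1 : Germ (𝓝 x) 𝔽) = 1 := Germ.coe_eq.2 hf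
    change (f.1 : Germ (𝓝 x) 𝔽) * _ = 0 at h
    rwa [h1, one_mul] at h)

/-- The grouplike elements of the local coalgebra `C_x`. -/
def grouplike (x : M) : Set (Stalk 𝔽 n x C) :=
  {ζ | comulAt 𝔽 n C x ζ = ζ ⊗ₜ[Plus (Cc 𝔽 n M)] ζ ∧ counitAt 𝔽 n C x ζ = 1}

variable {C}

/-- The element `c` is normalized at `x` if the germ of its counit at `x` is `1`. -/
def NormalizedAt (c : C) (x : M) : Prop := (Coalg.counit (R := Cc 𝔽 n M) c).1 =ᶠ[𝓝 x] 1

/-- The element `c` is normalized on `W` if it is normalized at each point of `W`. -/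
def NormalizedOn (c : C) (W : Set M) : Prop := ∀ x ∈ W, NormalizedAt 𝔽 n c x

variable {𝔽 n}

theorem NormalizedAt.eventually {c : C} {x : M} (h : NormalizedAt 𝔽 n c x) :
    ∀ᶠ y in 𝓝 x, NormalizedAt 𝔽 n c y := eventually_eventually_nhds.2 h

theorem toStalk_mem_grouplike {c : C} (hc : c ∈ weaklyGrouplike (Cc 𝔽 n M) C) {x : M}
    (hx : NormalizedAt 𝔽 n c x) : toStalk 𝔽 n x c ∈ grouplike 𝔽 n C x := by
  obtain ⟨c', hc'⟩ := hc
  have h1 : c = (Coalg.counit (R := Cc 𝔽 n M) c) • c' := by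
    conv_lhs => rw [← Coalg.counit_comul (R := Cc 𝔽 n M) c, hc', TensorProduct.lift.tmul]
    rfl
  have h2 : toStalk 𝔽 n x c = toStalk 𝔽 n x c' := by
    conv_lhs => rw [h1, ← ofR_smul, toStalk_smul, smul_toStalk_one hx]
  refine ⟨?_, Germ.coe_eq.2 hx⟩
  change tensorToStalk 𝔽 n C x (Coalg.comul c) = _
  rw [hc']
  change toStalk 𝔽 n x c ⊗ₜ[Plus (Cc 𝔽 n M)] toStalk 𝔽 n x c' = _
  rw [h2]

theorem toStalk_eq_eventually {c d : C} {x : M} (h : toStalk 𝔽 n x c = toStalk 𝔽 n x d) :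
    ∀ᶠ y in 𝓝 x, toStalk 𝔽 n y c = toStalk 𝔽 n y d := by
  rw [← sub_eq_zero, ← map_sub] at h
  obtain ⟨f, hf, hfc⟩ := toStalk_eq_zero.1 h
  filter_upwards [eventually_eventually_nhds.2 hf] with y hy
  rw [← sub_eq_zero, ← map_sub]
  exact toStalk_eq_zero.2 ⟨f, hy, hfc⟩

theorem tensorToStalk_eq_zero {x : M} {t : C ⊗[Plus (Cc 𝔽 n M)] C}
    (h : tensorToStalk 𝔽 n C x t = 0) : toStalk 𝔽 n x t = 0 := by
  have hl : ∀ c ∈ Nx 𝔽 n x C, ∀ d : C, toStalk 𝔽 n x (c ⊗ₜ[Plus (Cc 𝔽 n M)] d) = 0 := by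
    rintro c ⟨f, hf, hfc⟩ d
    exact toStalk_eq_zero.2 ⟨f, hf, by rw [TensorProduct.smul_tmul', hfc, TensorProduct.zero_tmul]⟩
  have hr : ∀ d ∈ Nx 𝔽 n x C, ∀ c : C, toStalk 𝔽 n x (c ⊗ₜ[Plus (Cc 𝔽 n M)] d) = 0 := by
    rintro d ⟨f, hf, hfd⟩ c
    exact toStalk_eq_zero.2 ⟨f, hf, by rw [← TensorProduct.tmul_smul, hfd, TensorProduct.tmul_zero]⟩
  let B : C →ₗ[Plus (Cc 𝔽 n M)] C →ₗ[Plus (Cc 𝔽 n M)] Stalk 𝔽 n x (C ⊗[Plus (Cc 𝔽 n M)] C) :=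
    (TensorProduct.mk (Plus (Cc 𝔽 n M)) C C).compr₂ (Nx 𝔽 n x _).mkQ
  let B' : C →ₗ[Plus (Cc 𝔽 n M)] Stalk 𝔽 n x C →ₗ[Plus (Cc 𝔽 n M)]
      Stalk 𝔽 n x (C ⊗[Plus (Cc 𝔽 n M)] C) :=
    { toFun := fun c => (Nx 𝔽 n x C).liftQ (B c) (fun d hd => hr d hd c)
      map_add' := fun c d => by
        refine LinearMap.ext fun s => ?_
        obtain ⟨e, rfl⟩ := Submodule.mkQ_surjective _ s
        change B (c + d) e = B c e + B d e
        rw [map_add, LinearMap.add_apply]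
      map_smul' := fun a c => by
        refine LinearMap.ext fun s => ?_
        obtain ⟨e, rfl⟩ := Submodule.mkQ_surjective _ s
        change B (a • c) e = a • B c e
        rw [map_smul, LinearMap.smul_apply] }
  let B'' := (Nx 𝔽 n x C).liftQ B' (fun c hc => by
    rw [LinearMap.mem_ker]
    refine LinearMap.ext fun s => ?_
    obtain ⟨e, rfl⟩ := Submodule.mkQ_surjective _ s
    exact hl c hc e)
  have key : TensorProduct.lift B'' ∘ₗ tensorToStalk 𝔽 n C x = (Nx 𝔽 n x _).mkQ :=
    TensorProduct.ext' fun c d => rfl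
  change (Nx 𝔽 n x _).mkQ t = 0
  rw [← key, LinearMap.comp_apply, h, map_zero]

theorem exists_weaklyGrouplike {x : M} {ζ : Stalk 𝔽 n x C} (hζ : ζ ∈ grouplike 𝔽 n C x) :
    ∃ c ∈ weaklyGrouplike (Cc 𝔽 n M) C, NormalizedAt 𝔽 n c x ∧ toStalk 𝔽 n x c = ζ := by
  obtain ⟨c, rfl⟩ := Submodule.mkQ_surjective _ ζ
  obtain ⟨h1, h2⟩ := hζ
  have hn : NormalizedAt 𝔽 n c x := Germ.coe_eq.1 h2
  have h3 : tensorToStalk 𝔽 n C x (Coalg.comul (R := Cc 𝔽 n M) c - c ⊗ₜ c) = 0 := by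
    rw [map_sub, sub_eq_zero]; exact h1
  obtain ⟨f, hf, hfc⟩ := toStalk_eq_zero.1 (tensorToStalk_eq_zero h3)
  rw [smul_sub, sub_eq_zero, ← map_smul, TensorProduct.smul_tmul', ofR_smul] at hfc
  refine ⟨f • c, ⟨c, hfc⟩, ?_, ?_⟩
  · rw [← ofR_smul, NormalizedAt, map_smul, ofR_smul]
    filter_upwards [hf, hn] with y h4 h5
    change f.1 y * (Coalg.counit (R := Cc 𝔽 n M) c).1 y = 1
    rw [h4, h5]; simp
  · rw [← ofR_smul]
    change (Nx 𝔽 n x C).mkQ _ = _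
    rw [map_smul]
    exact smul_toStalk_one hf _

end Local

/-! ### Smooth functions with compact support on a non-Hausdorff manifold -/

section NonHausdorff

/-- Sections, not necessarily continuous, of the sheaf of germs of functions on `E`. -/
abbrev GermSec (𝔽 : Type*) (E : Type*) [TopologicalSpace E] : Type _ :=
  ∀ y : E, Germ (𝓝 y) 𝔽

variable (𝔽 : Type*) [RCLike 𝔽] (n : ℕ) (E : Type*) [TopologicalSpace E]
  [ChartedSpace (EuclideanSpace ℝ (Fin n)) E]

variable {𝔽 n E} in
open Classical in
/-- The extension by zero of a smooth function with compact support on an open subset `U`. -/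
def extendByZero (U : TopologicalSpace.Opens E) (f : Cc 𝔽 n U) : GermSec 𝔽 E := fun y =>
  if y ∈ U then ((Function.extend Subtype.val f.1 0 : E → 𝔽) : Germ (𝓝 y) 𝔽) else 0

/-- Smooth functions with compact support on a manifold `E` which need not be Hausdorff: finite sums
of extensions by zero of smooth functions with compact support on Hausdorff open subsets. -/
def CcSec : AddSubgroup (GermSec 𝔽 E) :=
  AddSubgroup.closure {u | ∃ (U : TopologicalSpace.Opens E) (_ : T2Space U) (f : Cc 𝔽 n U),
    u = extendByZero U f}

variable {𝔽 n E}

theorem Cc.contMDiffAt_extend {U : TopologicalSpace.Opens E} (f : Cc 𝔽 n U) {y : E} (hy : y ∈ U) :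
    ContMDiffAt (𝓡 n) 𝓘(ℝ, 𝔽) ∞ (Function.extend Subtype.val f.1 0 : E → 𝔽) y := by
  rw [← contMDiffAt_subtype_iff (U := U) (x := ⟨y, hy⟩)]
  refine (f.2.1 ⟨y, hy⟩).congr_of_eventuallyEq (Eventually.of_forall fun z => ?_)
  exact Subtype.val_injective.extend_apply f.1 0 z

theorem extend_apply_of_mem {U : TopologicalSpace.Opens E} (f : U → 𝔽) {y : E} (hy : y ∈ U) :
    (Function.extend Subtype.val f 0 : E → 𝔽) y = f ⟨y, hy⟩ :=
  Subtype.val_injective.extend_apply f 0 ⟨y, hy⟩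

theorem extendByZero_add (U : TopologicalSpace.Opens E) (f g : Cc 𝔽 n U) :
    extendByZero U (f + g) = extendByZero U f + extendByZero U g := by
  funext y
  by_cases hy : y ∈ U
  · simp only [extendByZero, Pi.add_apply, if_pos hy]
    refine Germ.coe_eq.2 ?_
    filter_upwards [U.isOpen.mem_nhds hy] with z hz
    change _ = (Function.extend Subtype.val f.1 0 : E → 𝔽) z + (Function.extend Subtype.val g.1 0 : E → 𝔽) z
    rw [extend_apply_of_mem _ hz, extend_apply_of_mem _ hz, extend_apply_of_mem _ hz]
    rfl
  · simp [extendByZero, hy]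

theorem extendByZero_zero (U : TopologicalSpace.Opens E) :
    extendByZero U (0 : Cc 𝔽 n U) = 0 := by
  have h := extendByZero_add U (0 : Cc 𝔽 n U) 0
  simpa using h

/-- The germ at a point of an open subset `O`, regarded as a germ in the ambient space. -/
def pushGerm {O : TopologicalSpace.Opens E} (y : O) : Germ (𝓝 y) 𝔽 → Germ (𝓝 (y : E)) 𝔽 :=
  Germ.map' (fun g => (Function.extend Subtype.val g 0 : E → 𝔽)) (by
    intro g g' h
    rw [← O.isOpen.isOpenEmbedding_subtypeVal.map_nhds_eq y]
    refine eventually_map.2 ?_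
    filter_upwards [h] with z hz
    rw [Subtype.val_injective.extend_apply, Subtype.val_injective.extend_apply, hz])

theorem pushGerm_add {O : TopologicalSpace.Opens E} (y : O) (a b : Germ (𝓝 y) 𝔽) :
    pushGerm y (a + b) = pushGerm y a + pushGerm y b := by
  induction a using Germ.inductionOn with | _ f
  induction b using Germ.inductionOn with | _ g
  refine Germ.coe_eq.2 ?_
  filter_upwards [O.isOpen.mem_nhds y.2] with z hz
  change _ = (Function.extend Subtype.val f 0 : E → 𝔽) z + (Function.extend Subtype.val g 0 : E → 𝔽) z
  rw [extend_apply_of_mem _ hz, extend_apply_of_mem _ hz, extend_apply_of_mem _ hz]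

theorem pushGerm_zero {O : TopologicalSpace.Opens E} (y : O) :
    pushGerm y (0 : Germ (𝓝 y) 𝔽) = 0 := by
  have h := pushGerm_add y (0 : Germ (𝓝 y) 𝔽) 0
  simpa using h

open Classical in
/-- Extension by zero of sections over an open subset `O`. -/
def extendSec (O : TopologicalSpace.Opens E) : GermSec 𝔽 O →+ GermSec 𝔽 E where
  toFun u z := if h : z ∈ O then pushGerm ⟨z, h⟩ (u ⟨z, h⟩) else 0
  map_zero' := by
    funext z
    by_cases h : z ∈ O
    · simp only [dif_pos h]; exact pushGerm_zero _
    · simp [h]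
  map_add' u v := by
    funext z
    by_cases h : z ∈ O
    · simp only [dif_pos h, Pi.add_apply]; exact pushGerm_add _ _ _
    · simp [h]

open Classical in
theorem extendSec_apply (O : TopologicalSpace.Opens E) (u : GermSec 𝔽 O) (z : E) :
    extendSec O u z = if h : z ∈ O then pushGerm ⟨z, h⟩ (u ⟨z, h⟩) else 0 := rfl

theorem extendSec_mem (O : TopologicalSpace.Opens E) {u : GermSec 𝔽 O} (hu : u ∈ CcSec 𝔽 n O) :
    extendSec O u ∈ CcSec 𝔽 n E := by
  suffices h : CcSec 𝔽 n O ≤ (CcSec 𝔽 n E).comap (extendSec O) from h hu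
  refine (AddSubgroup.closure_le _).2 ?_
  rintro _ ⟨U, hU, f, rfl⟩
  refine AddSubgroup.subset_closure ?_
  let G : O → 𝔽 := Function.extend Subtype.val f.1 0
  let F : E → 𝔽 := Function.extend Subtype.val G 0
  let U' : TopologicalSpace.Opens E := ⟨Subtype.val '' (U : Set O),
    O.isOpen.isOpenMap_subtype_val _ U.isOpen⟩
  have hF : ∀ (z : E) (h : z ∈ O) (h' : (⟨z, h⟩ : O) ∈ U), F z = f.1 ⟨⟨z, h⟩, h'⟩ := by
    intro z h h'
    rw [← extend_apply_of_mem f.1 h']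
    exact extend_apply_of_mem _ h
  have hmem : ∀ z : U', ∃ h : z.1 ∈ O, (⟨z.1, h⟩ : O) ∈ U := by
    rintro ⟨_, w, hw, rfl⟩
    exact ⟨w.2, hw⟩
  let j : U → U' := fun w => ⟨w.1.1, w.1, w.2, rfl⟩
  have hj : Continuous j := (continuous_subtype_val.comp continuous_subtype_val).subtype_mk _
  let i : U' → U := fun z => ⟨⟨z.1, (hmem z).1⟩, (hmem z).2⟩
  have hi : Continuous i := (continuous_subtype_val.subtype_mk _).subtype_mk _
  have hii : Function.Injective i := by
    intro a b hab
    exact Subtype.ext (congrArg (fun w : U => w.1.1) hab)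
  have hT : T2Space U' := T2Space.of_injective_continuous hii hi
  have hFi : ∀ z : U', F z.1 = f.1 (i z) := fun z => hF z.1 (hmem z).1 (hmem z).2
  let f' : Cc 𝔽 n U' := ⟨fun z => F z.1, by
    intro z
    rw [contMDiffAt_subtype_iff, ← contMDiffAt_subtype_iff (U := O) (x := ⟨z.1, (hmem z).1⟩)]
    refine (Cc.contMDiffAt_extend f (hmem z).2).congr_of_eventuallyEq
      (Eventually.of_forall fun w => ?_)
    exact Subtype.val_injective.extend_apply G 0 w, by
    refine HasCompactSupport.intro (f.2.2.image hj) ?_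
    intro z hz
    rw [hFi]
    by_contra hne
    exact hz ⟨i z, subset_tsupport _ hne, rfl⟩⟩
  refine ⟨U', hT, f', ?_⟩
  funext z
  by_cases hz : z ∈ U'
  · obtain ⟨h, h'⟩ := hmem ⟨z, hz⟩
    rw [extendSec_apply]
    simp only [extendByZero, dif_pos h, if_pos h', if_pos hz]
    change ((F : E → 𝔽) : Germ (𝓝 z) 𝔽) = _
    refine Germ.coe_eq.2 ?_
    filter_upwards [U'.isOpen.mem_nhds hz] with w hw
    exact (extend_apply_of_mem f'.1 hw).symm
  · rw [extendSec_apply]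
    by_cases h : z ∈ O
    · have h' : (⟨z, h⟩ : O) ∉ U := fun h' => hz ⟨⟨z, h⟩, h', rfl⟩
      simp only [extendByZero, dif_pos h, if_neg h', if_neg hz]
      exact pushGerm_zero _
    · simp [extendByZero, hz, h]

/-- The map `inc₊` induced by the inclusion of an open subset: extension by zero. -/
def incPlus (𝔽 : Type*) [RCLike 𝔽] (n : ℕ) {E : Type*} [TopologicalSpace E]
    [ChartedSpace (EuclideanSpace ℝ (Fin n)) E] (O : TopologicalSpace.Opens E) :
    CcSec 𝔽 n O →+ CcSec 𝔽 n E where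
  toFun u := ⟨extendSec O u.1, extendSec_mem O u.2⟩
  map_zero' := Subtype.ext (map_zero (extendSec O))
  map_add' u v := Subtype.ext (map_add (extendSec O) u.1 v.1)

end NonHausdorff

/-! ### The spectral sheaf -/

section Spectral

variable (𝔽 : Type*) [RCLike 𝔽] (n : ℕ) (M : Type*) [TopologicalSpace M]
  [ChartedSpace (EuclideanSpace ℝ (Fin n)) M] [IsManifold (𝓡 n) ∞ M] [T2Space M]
  (C : Type*) [AddCommGroup C] [NUModule (Cc 𝔽 n M) C] [Coalg (Cc 𝔽 n M) C]

/-- The total space of the spectral sheaf: the stalk at `x` is the set of grouplike elements of the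
local coalgebra `C_x`. -/
@[ext] structure Esp where
  /-- The projection to `M`. -/
  pt : M
  val : Stalk 𝔽 n pt C
  mem : val ∈ grouplike 𝔽 n C pt

variable {𝔽 n M C}

/-- The set `c_W` of all `c_x`, `x ∈ W`. -/
def basicSet (c : C) (W : Set M) : Set (Esp 𝔽 n M C) :=
  {ζ | ζ.pt ∈ W ∧ toStalk 𝔽 n ζ.pt c = ζ.val}

variable (𝔽 n M C) in
/-- The sets `c_W`, for `W` open and `c` weakly grouplike and normalized on `W`. -/
def basicSets : Set (Set (Esp 𝔽 n M C)) :=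
  {S | ∃ c ∈ weaklyGrouplike (Cc 𝔽 n M) C, ∃ W : Set M, IsOpen W ∧ NormalizedOn 𝔽 n c W ∧
    S = basicSet c W}

/-- The topology of the spectral sheaf. -/
instance : TopologicalSpace (Esp 𝔽 n M C) := TopologicalSpace.generateFrom (basicSets 𝔽 n M C)

theorem isOpen_basicSet {c : C} (hc : c ∈ weaklyGrouplike (Cc 𝔽 n M) C) {W : Set M}
    (hW : IsOpen W) (h : NormalizedOn 𝔽 n c W) :
    IsOpen (basicSet c W : Set (Esp 𝔽 n M C)) :=
  TopologicalSpace.isOpen_generateFrom_of_mem ⟨c, hc, W, hW, h, rfl⟩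

/-- Every point of the spectral sheaf has basic neighbourhoods. -/
theorem exists_basicSet (ζ : Esp 𝔽 n M C) {V : Set M} (hV : V ∈ 𝓝 ζ.pt) :
    ∃ c ∈ weaklyGrouplike (Cc 𝔽 n M) C, ∃ W : Set M, IsOpen W ∧ NormalizedOn 𝔽 n c W ∧ W ⊆ V ∧
      ζ ∈ basicSet c W := by
  obtain ⟨c, hc, hn, hcζ⟩ := exists_weaklyGrouplike ζ.mem
  obtain ⟨W, hW, hWo, hxW⟩ := mem_nhds_iff.1 (inter_mem hV hn.eventually)
  exact ⟨c, hc, W, hWo, fun y hy => (hW hy).2, fun y hy => (hW hy).1, hxW, hcζ⟩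

theorem isTopologicalBasis_basicSets :
    TopologicalSpace.IsTopologicalBasis (basicSets 𝔽 n M C) where
  exists_subset_inter := by
    rintro _ ⟨c, hc, W, hW, hcW, rfl⟩ _ ⟨d, hd, V, hV, hdV, rfl⟩ ζ ⟨⟨h1, h2⟩, ⟨h3, h4⟩⟩
    obtain ⟨Z, hZ, hZo, hxZ⟩ := mem_nhds_iff.1
      (inter_mem (inter_mem (hW.mem_nhds h1) (hV.mem_nhds h3))
        (toStalk_eq_eventually (h2.trans h4.symm)))
    refine ⟨basicSet c Z, ⟨c, hc, Z, hZo, fun y hy => hcW y (hZ hy).1.1, rfl⟩, ⟨hxZ, h2⟩, ?_⟩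
    rintro ξ ⟨h5, h6⟩
    exact ⟨⟨(hZ h5).1.1, h6⟩, (hZ h5).1.2, ((hZ h5).2 : toStalk 𝔽 n ξ.pt c = _) ▸ h6⟩
  sUnion_eq := by
    refine Set.eq_univ_of_forall fun ζ => ?_
    obtain ⟨c, hc, W, hW, hcW, -, hζ⟩ := exists_basicSet ζ univ_mem
    exact ⟨_, ⟨c, hc, W, hW, hcW, rfl⟩, hζ⟩
  eq_generateFrom := rfl

theorem continuous_pt : Continuous (Esp.pt : Esp 𝔽 n M C → M) := by
  refine continuous_iff_continuousAt.2 fun ζ => tendsto_def.2 fun V hV => ?_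
  obtain ⟨c, hc, W, hW, hcW, hWV, hζ⟩ := exists_basicSet ζ hV
  exact mem_of_superset ((isOpen_basicSet hc hW hcW).mem_nhds hζ) fun ξ hξ => hWV hξ.1

/-- The section `x ↦ c_x` over `W`. -/
def basicSection {c : C} (hc : c ∈ weaklyGrouplike (Cc 𝔽 n M) C) {W : Set M}
    (h : NormalizedOn 𝔽 n c W) (x : W) : Esp 𝔽 n M C :=
  ⟨x.1, toStalk 𝔽 n x.1 c, toStalk_mem_grouplike hc (h x.1 x.2)⟩

theorem basicSection_of_mem {c : C} (hc : c ∈ weaklyGrouplike (Cc 𝔽 n M) C) {W : Set M}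
    (h : NormalizedOn 𝔽 n c W) {ζ : Esp 𝔽 n M C} (hζ : ζ ∈ basicSet c W) :
    basicSection hc h ⟨ζ.pt, hζ.1⟩ = ζ := by
  exact Esp.ext rfl (heq_of_eq hζ.2)

theorem continuous_basicSection {c : C} (hc : c ∈ weaklyGrouplike (Cc 𝔽 n M) C) {W : Set M}
    (h : NormalizedOn 𝔽 n c W) : Continuous (basicSection hc h) := by
  refine continuous_generateFrom_iff.2 ?_
  rintro _ ⟨d, hd, V, hV, hdV, rfl⟩
  refine isOpen_iff_mem_nhds.2 ?_
  rintro x ⟨h1, h2⟩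
  have h3 := inter_mem (hV.mem_nhds h1) (toStalk_eq_eventually h2)
  filter_upwards [continuous_subtype_val.continuousAt h3] with y hy
  exact ⟨hy.1, hy.2⟩

theorem isOpenMap_pt : IsOpenMap (Esp.pt : Esp 𝔽 n M C → M) := by
  refine isTopologicalBasis_basicSets.isOpenMap_iff.2 ?_
  rintro _ ⟨c, hc, W, hW, hcW, rfl⟩
  convert hW using 1
  ext x
  constructor
  · rintro ⟨ζ, hζ, rfl⟩
    exact hζ.1
  · intro hx
    exact ⟨basicSection hc hcW ⟨x, hx⟩, ⟨hx, rfl⟩, rfl⟩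

theorem injOn_pt (c : C) (W : Set M) :
    Set.InjOn (Esp.pt : Esp 𝔽 n M C → M) (basicSet c W) := by
  rintro ⟨x, v, hv⟩ ⟨h1, h2⟩ ⟨y, w, hw⟩ ⟨h3, h4⟩ hxy
  obtain rfl : x = y := hxy
  obtain rfl : v = w := h2.symm.trans h4
  rfl

/-- The projection of the spectral sheaf is a local homeomorphism. -/
theorem isLocalHomeomorph_pt : IsLocalHomeomorph (Esp.pt : Esp 𝔽 n M C → M) := by
  refine isLocalHomeomorph_iff_isOpenEmbedding_restrict.2 fun ζ => ?_
  obtain ⟨c, hc, W, hW, hcW, -, hζ⟩ := exists_basicSet ζ univ_mem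
  have ho := isOpen_basicSet hc hW hcW
  refine ⟨basicSet c W, ho.mem_nhds hζ, .of_continuous_injective_isOpenMap
    (continuous_pt.comp continuous_subtype_val) ?_ (isOpenMap_pt.comp ho.isOpenMap_subtype_val)⟩
  intro a b hab
  exact Subtype.ext (injOn_pt c W a.2 b.2 hab)

/-- The smooth structure of the spectral sheaf: the one for which the projection is a local
diffeomorphism. -/
instance : ChartedSpace (EuclideanSpace ℝ (Fin n)) (Esp 𝔽 n M C) :=
  etaleChartedSpace n isLocalHomeomorph_pt

instance : IsManifold (𝓡 n) ∞ (Esp 𝔽 n M C) := etale_isManifold isLocalHomeomorph_pt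

end Spectral

/-! ### The counit of the adjunction -/

section Counit

variable {𝔽 : Type*} [RCLike 𝔽] {n : ℕ} {M : Type*} [TopologicalSpace M]
  [ChartedSpace (EuclideanSpace ℝ (Fin n)) M] [IsManifold (𝓡 n) ∞ M] [T2Space M]
  {C : Type*} [AddCommGroup C] [NUModule (Cc 𝔽 n M) C] [Coalg (Cc 𝔽 n M) C]

open Classical in
/-- The section `f ∘ π|_{c_W}`, extended by zero. -/
def basicFun (c : C) (W : Set M) (f : Cc 𝔽 n M) : GermSec 𝔽 (Esp 𝔽 n M C) := fun ζ =>
  if ζ ∈ basicSet c W then ((fun ξ : Esp 𝔽 n M C => f.1 ξ.pt) : Germ (𝓝 ζ) 𝔽) else 0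

/-- The section `f ∘ π|_{c_W}` is a smooth function with compact support on the spectral sheaf. -/
theorem basicFun_mem {c : C} (hc : c ∈ weaklyGrouplike (Cc 𝔽 n M) C) {W : Set M}
    (hW : IsOpen W) (hcW : NormalizedOn 𝔽 n c W) (f : Cc 𝔽 n M) (hf : tsupport f.1 ⊆ W) :
    basicFun c W f ∈ CcSec 𝔽 n (Esp 𝔽 n M C) := by
  let U : TopologicalSpace.Opens (Esp 𝔽 n M C) := ⟨basicSet c W, isOpen_basicSet hc hW hcW⟩
  have hT : T2Space U := T2Space.of_injective_continuous (f := fun ζ : U => ζ.1.pt)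
    (fun a b hab => Subtype.ext (injOn_pt c W a.2 b.2 hab))
    (continuous_pt.comp continuous_subtype_val)
  let σ : W → U := fun x => ⟨basicSection hc hcW x, x.2, rfl⟩
  have hσ : Continuous σ := (continuous_basicSection hc hcW).subtype_mk _
  let g : Cc 𝔽 n U := ⟨fun ζ => f.1 ζ.1.pt, by
    intro ζ
    rw [contMDiffAt_subtype_iff (f := fun ξ : Esp 𝔽 n M C => f.1 ξ.pt)]
    exact (etale_contMDiffAt_iff isLocalHomeomorph_pt).2 ⟨f.1, f.2.1 _, EventuallyEq.rfl⟩, by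
    have hK : IsCompact ((Subtype.val : W → M) ⁻¹' tsupport f.1) :=
      (Topology.IsInducing.subtypeVal.isCompact_preimage_iff (by simpa using hf)).2 f.2.2
    refine HasCompactSupport.intro (hK.image hσ) ?_
    intro ζ hζ
    by_contra hne
    refine hζ ⟨⟨ζ.1.pt, ζ.2.1⟩, subset_tsupport _ hne, ?_⟩
    exact Subtype.ext (basicSection_of_mem hc hcW ζ.2)⟩
  refine AddSubgroup.subset_closure ⟨U, hT, g, ?_⟩
  funext ζ
  by_cases hζ : ζ ∈ U
  · have hζ' : ζ ∈ basicSet c W := hζ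
    simp only [basicFun, extendByZero, if_pos hζ, if_pos hζ']
    refine Germ.coe_eq.2 ?_
    filter_upwards [U.isOpen.mem_nhds hζ] with ξ hξ
    exact (extend_apply_of_mem g.1 hξ).symm
  · have hζ' : ζ ∉ basicSet c W := hζ
    simp only [basicFun, extendByZero, if_neg hζ, if_neg hζ']

/-- The additive relation generated by the pairs `(f ∘ π|_{c_W}, f c)`. -/
def psiRel (𝔽 : Type*) [RCLike 𝔽] (n : ℕ) (M : Type*) [TopologicalSpace M]
    [ChartedSpace (EuclideanSpace ℝ (Fin n)) M] [IsManifold (𝓡 n) ∞ M] [T2Space M]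
    (C : Type*) [AddCommGroup C] [NUModule (Cc 𝔽 n M) C] [Coalg (Cc 𝔽 n M) C] :
    AddSubgroup (GermSec 𝔽 (Esp 𝔽 n M C) × C) :=
  AddSubgroup.closure {q | ∃ c ∈ weaklyGrouplike (Cc 𝔽 n M) C, ∃ W : Set M, IsOpen W ∧
    NormalizedOn 𝔽 n c W ∧ ∃ f : Cc 𝔽 n M, tsupport f.1 ⊆ W ∧ q = (basicFun c W f, f • c)}

theorem germ_zero_of_notMem {f : Cc 𝔽 n M} {W : Set M} (hf : tsupport f.1 ⊆ W) {x : M}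
    (hx : x ∉ W) : f.1 =ᶠ[𝓝 x] 0 :=
  notMem_tsupport_iff_eventuallyEq.1 fun h => hx (hf h)

/-- Related pairs are related locally at each point. -/
theorem psiRel_local {q : GermSec 𝔽 (Esp 𝔽 n M C) × C} (hq : q ∈ psiRel 𝔽 n M C) (x : M) :
    ∃ F : grouplike 𝔽 n C x →₀ Cc 𝔽 n M,
      toStalk 𝔽 n x q.2 = F.sum (fun ζ f => ofR f • ζ.1) ∧
      ∀ ζ : grouplike 𝔽 n C x,
        q.1 ⟨x, ζ.1, ζ.2⟩ = ((fun ξ : Esp 𝔽 n M C => (F ζ).1 ξ.pt) : Germ (𝓝 _) 𝔽) := by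
  have h0 : ∀ ζ : grouplike 𝔽 n C x, ofR (0 : Cc 𝔽 n M) • ζ.1 = 0 := fun ζ =>
    smul_toStalk_zero EventuallyEq.rfl _
  have hadd : ∀ (ζ : grouplike 𝔽 n C x) (f g : Cc 𝔽 n M),
      ofR (f + g) • ζ.1 = ofR f • ζ.1 + ofR g • ζ.1 := by
    intro ζ f g
    have h : ofR (f + g) = ofR f + ofR g := Unitization.inr_add ℤ f g
    rw [h, add_smul]
  have hneg : ∀ (ζ : grouplike 𝔽 n C x) (f : Cc 𝔽 n M), ofR (-f) • ζ.1 = -(ofR f • ζ.1) := by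
    intro ζ f
    rw [eq_neg_iff_add_eq_zero, ← hadd, neg_add_cancel, h0]
  induction hq using AddSubgroup.closure_induction with
  | mem q hq =>
    obtain ⟨c, hc, W, hW, hcW, f, hf, rfl⟩ := hq
    by_cases hx : x ∈ W
    · let ζ₀ : grouplike 𝔽 n C x := ⟨toStalk 𝔽 n x c, toStalk_mem_grouplike hc (hcW x hx)⟩
      refine ⟨Finsupp.single ζ₀ f, ?_, fun ζ => ?_⟩
      · rw [Finsupp.sum_single_index (h0 _)]
        change toStalk 𝔽 n x (f • c) = _
        rw [← ofR_smul, toStalk_smul]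
      · by_cases hζ : ζ₀ = ζ
        · subst hζ
          rw [Finsupp.single_eq_same]
          exact if_pos ⟨hx, rfl⟩
        · rw [Finsupp.single_eq_of_ne' hζ]
          exact if_neg fun h => hζ (Subtype.ext h.2)
    · refine ⟨0, ?_, fun ζ => ?_⟩
      · rw [Finsupp.sum_zero_index]
        change toStalk 𝔽 n x (f • c) = _
        rw [← ofR_smul, toStalk_smul]
        exact smul_toStalk_zero (germ_zero_of_notMem hf hx) _
      · exact if_neg fun h => hx h.1
  | zero => exact ⟨0, by rw [Finsupp.sum_zero_index]; exact map_zero _, fun ζ => rfl⟩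
  | add q r _ _ hq hr =>
    obtain ⟨F, hF1, hF2⟩ := hq
    obtain ⟨G, hG1, hG2⟩ := hr
    refine ⟨F + G, ?_, fun ζ => ?_⟩
    · rw [Finsupp.sum_add_index' h0 hadd, ← hF1, ← hG1]
      exact map_add _ _ _
    · change q.1 _ + r.1 _ = _
      rw [hF2, hG2]
      rfl
  | neg q _ hq =>
    obtain ⟨F, hF1, hF2⟩ := hq
    refine ⟨-F, ?_, fun ζ => ?_⟩
    · rw [Finsupp.sum_neg_index h0]
      simp only [hneg]
      rw [Finsupp.sum_neg, ← hF1]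
      exact map_neg _ _
    · change -q.1 _ = _
      rw [hF2]
      rfl

theorem eq_zero_of_toStalk {c : C} (h : ∀ x : M, toStalk 𝔽 n x c = 0) : c = 0 := by
  obtain ⟨r, hr⟩ := Coalg.locallyUnitary (R := Cc 𝔽 n M) ({c} : Finset C)
  have hr' : r • c = c := hr c (by simp)
  rw [← hr']
  refine Cc.induction (fun f : Cc 𝔽 n M => f • c = 0) (nu_zero_smul c)
    (fun f g hf hg => by rw [NUModule.add_smul', hf, hg, add_zero]) (fun x => ?_) r
  obtain ⟨p, hp, hpc⟩ := toStalk_eq_zero.1 (h x)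
  refine ⟨_, hp, fun f hf => ?_⟩
  have : f = f * p := by
    ext y
    change f.1 y = f.1 y * p.1 y
    by_cases hy : y ∈ tsupport f.1
    · rw [show p.1 y = 1 from hf hy, mul_one]
    · rw [image_eq_zero_of_notMem_tsupport hy, zero_mul]
  rw [ofR_smul] at hpc
  rw [this, NUModule.mul_smul', hpc, nu_smul_zero]

/-- The relation is single-valued. -/
theorem psiRel_unique {d : C} (h : ((0 : GermSec 𝔽 (Esp 𝔽 n M C)), d) ∈ psiRel 𝔽 n M C) :
    d = 0 := by
  refine eq_zero_of_toStalk (𝔽 := 𝔽) (n := n) (M := M) fun x => ?_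
  obtain ⟨F, hF1, hF2⟩ := psiRel_local h x
  change toStalk 𝔽 n x d = _ at hF1
  rw [hF1]
  refine Finset.sum_eq_zero fun ζ _ => smul_toStalk_zero ?_ _
  have h1 : (fun ξ : Esp 𝔽 n M C => (F ζ).1 ξ.pt) =ᶠ[𝓝 ⟨x, ζ.1, ζ.2⟩] fun _ => 0 :=
    Germ.coe_eq.1 (hF2 ζ).symm
  have h2 : map (Esp.pt : Esp 𝔽 n M C → M) (𝓝 ⟨x, ζ.1, ζ.2⟩) = 𝓝 x :=
    isLocalHomeomorph_pt.map_nhds_eq _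
  rw [← h2]
  exact eventually_map.2 h1

/-- The relation is defined everywhere: every smooth function with compact support on the spectral
sheaf is a sum of functions of the form `f ∘ π|_{c_W}`. -/
theorem psiRel_exists {u : GermSec 𝔽 (Esp 𝔽 n M C)} (hu : u ∈ CcSec 𝔽 n (Esp 𝔽 n M C)) :
    ∃ d : C, (u, d) ∈ psiRel 𝔽 n M C := by
  suffices h : CcSec 𝔽 n (Esp 𝔽 n M C) ≤ (psiRel 𝔽 n M C).map (AddMonoidHom.fst _ _) by
    obtain ⟨q, hq, rfl⟩ := h hu
    exact ⟨q.2, hq⟩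
  refine (AddSubgroup.closure_le _).2 ?_
  rintro _ ⟨U, hU, h, rfl⟩
  refine Cc.induction (fun h : Cc 𝔽 n U =>
    extendByZero U h ∈ (psiRel 𝔽 n M C).map (AddMonoidHom.fst _ _)) ?_ ?_ ?_ h
  · change extendByZero U 0 ∈ _
    rw [extendByZero_zero]
    exact zero_mem _
  · intro f g hf hg
    change extendByZero U (f + g) ∈ _
    rw [extendByZero_add]
    exact add_mem hf hg
  · intro y
    obtain ⟨_, ⟨c, hc, W, hW, hcW, rfl⟩, hyW, hWU⟩ :=
      isTopologicalBasis_basicSets.exists_subset_of_mem_open y.2 U.isOpen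
    have ho := isOpen_basicSet hc hW hcW
    refine ⟨Subtype.val ⁻¹' basicSet c W,
      (ho.preimage continuous_subtype_val).mem_nhds hyW, fun g hg => ?_⟩
    set G : Esp 𝔽 n M C → 𝔽 := Function.extend Subtype.val g.1 0 with hG
    have hGU : ∀ (ζ : Esp 𝔽 n M C) (h : ζ ∈ U), G ζ = g.1 ⟨ζ, h⟩ := fun ζ h =>
      extend_apply_of_mem g.1 h
    let K : Set M := (fun ζ : U => ζ.1.pt) '' tsupport g.1
    have hK : IsCompact K :=
      IsCompact.image g.2.2 (continuous_pt.comp continuous_subtype_val)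
    have hKW : K ⊆ W := by
      rintro _ ⟨ζ, hζ, rfl⟩
      exact (hg hζ).1
    classical
    let F : M → 𝔽 := fun x => if hx : x ∈ W then G (basicSection hc hcW ⟨x, hx⟩) else 0
    have hF : ∀ ζ ∈ basicSet c W, F ζ.pt = G ζ := by
      intro ζ hζ
      change (if hx : ζ.pt ∈ W then G (basicSection hc hcW ⟨ζ.pt, hx⟩) else 0) = _
      rw [dif_pos hζ.1, basicSection_of_mem hc hcW hζ]
    have hF0 : ∀ x, x ∉ K → F x = 0 := by
      intro x hx
      by_cases hxW : x ∈ W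
      · have hmem : basicSection hc hcW ⟨x, hxW⟩ ∈ basicSet c W := ⟨hxW, rfl⟩
        change F (basicSection hc hcW ⟨x, hxW⟩).pt = 0
        rw [hF _ hmem, hGU _ (hWU hmem)]
        by_contra hne
        exact hx ⟨_, subset_tsupport _ hne, rfl⟩
      · exact dif_neg hxW
    have hFs : tsupport F ⊆ K := closure_minimal (fun x hx => by
      by_contra hxK
      exact hx (hF0 x hxK)) hK.isClosed
    let f : Cc 𝔽 n M := ⟨F, by
      intro x
      by_cases hxW : x ∈ W
      · have hmem : basicSection hc hcW ⟨x, hxW⟩ ∈ basicSet c W := ⟨hxW, rfl⟩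
        obtain ⟨k, hk, hGk⟩ := (etale_contMDiffAt_iff isLocalHomeomorph_pt).1
          (Cc.contMDiffAt_extend g (hWU hmem))
        refine ContMDiffAt.congr_of_eventuallyEq hk ?_
        have h2 : map (Esp.pt : Esp 𝔽 n M C → M) (𝓝 (basicSection hc hcW ⟨x, hxW⟩)) = 𝓝 x :=
          isLocalHomeomorph_pt.map_nhds_eq _
        rw [← h2]
        refine eventually_map.2 ?_
        filter_upwards [hGk, ho.mem_nhds hmem] with ξ h3 h4
        rw [hF ξ h4]
        exact h3
      · refine (contMDiffAt_const (c := (0 : 𝔽))).congr_of_eventuallyEq ?_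
        filter_upwards [hK.isClosed.isOpen_compl.mem_nhds fun h => hxW (hKW h)] with z hz
        exact hF0 z hz, hK.of_isClosed_subset (isClosed_tsupport _) hFs⟩
    refine ⟨(basicFun c W f, f • c), AddSubgroup.subset_closure
      ⟨c, hc, W, hW, hcW, f, hFs.trans hKW, rfl⟩, ?_⟩
    change basicFun c W f = extendByZero U g
    funext ζ
    by_cases hζW : ζ ∈ basicSet c W
    · have hζU : ζ ∈ U := hWU hζW
      simp only [basicFun, extendByZero, if_pos hζU, if_pos hζW]
      refine Germ.coe_eq.2 ?_
      filter_upwards [ho.mem_nhds hζW] with ξ hξ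
      exact hF ξ hξ
    · by_cases hζU : ζ ∈ U
      · simp only [basicFun, extendByZero, if_pos hζU, if_neg hζW]
        refine (Germ.coe_eq.2 ?_ : ((0 : Esp 𝔽 n M C → 𝔽) : Germ (𝓝 ζ) 𝔽) = _)
        have h1 : g.1 =ᶠ[𝓝 ⟨ζ, hζU⟩] 0 :=
          notMem_tsupport_iff_eventuallyEq.1 fun h => hζW (hg h)
        have h2 := U.isOpen.isOpenEmbedding_subtypeVal.map_nhds_eq ⟨ζ, hζU⟩
        change _ =ᶠ[𝓝 ((⟨ζ, hζU⟩ : U) : Esp 𝔽 n M C)] _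
        rw [← h2]
        refine eventually_map.2 ?_
        filter_upwards [h1] with ξ hξ
        exact ((hGU ξ.1 ξ.2).trans hξ).symm
      · simp only [basicFun, extendByZero, if_neg hζU, if_neg hζW]

variable (𝔽 n M C)

/-- The map `Ψ_C` from the smooth functions with compact support on the spectral sheaf of `C` to
`C`, which sends a finite sum of functions `fᵢ ∘ π|_{(cᵢ)_{Wᵢ}}` to the sum of the `fᵢ cᵢ`. -/
def Psi : CcSec 𝔽 n (Esp 𝔽 n M C) →+ C where
  toFun u := (psiRel_exists u.2).choose
  map_zero' := psiRel_unique (psiRel_exists (zero_mem (CcSec 𝔽 n (Esp 𝔽 n M C)))).choose_spec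
  map_add' u v := by
    have h := sub_mem (psiRel_exists (u + v).2).choose_spec
      (add_mem (psiRel_exists u.2).choose_spec (psiRel_exists v.2).choose_spec)
    rw [Prod.mk_add_mk, Prod.mk_sub_mk] at h
    have h0 : ((u + v : CcSec 𝔽 n (Esp 𝔽 n M C)) : GermSec 𝔽 (Esp 𝔽 n M C)) - (u.1 + v.1) = 0 :=
      sub_self _
    rw [h0] at h
    exact sub_eq_zero.1 (psiRel_unique h)

variable {𝔽 n M C}

theorem Psi_basicFun {c : C} (hc : c ∈ weaklyGrouplike (Cc 𝔽 n M) C) {W : Set M}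
    (hW : IsOpen W) (hcW : NormalizedOn 𝔽 n c W) (f : Cc 𝔽 n M) (hf : tsupport f.1 ⊆ W) :
    Psi 𝔽 n M C ⟨basicFun c W f, basicFun_mem hc hW hcW f hf⟩ = f • c := by
  have h1 := (psiRel_exists (basicFun_mem hc hW hcW f hf)).choose_spec
  have h2 : (basicFun c W f, f • c) ∈ psiRel 𝔽 n M C :=
    AddSubgroup.subset_closure ⟨c, hc, W, hW, hcW, f, hf, rfl⟩
  have h := sub_mem h1 h2
  rw [Prod.mk_sub_mk, sub_self] at h
  exact sub_eq_zero.1 (psiRel_unique h)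

variable (𝔽 n M)

/-- The open subsheaf of the spectral sheaf determined by a set `Λ` of weakly grouplike elements:
its stalk at `x` consists of all `c_x` with `c ∈ Λ` normalized at `x`. -/
def EspSub (Λ : Set C) (hΛ : Λ ⊆ weaklyGrouplike (Cc 𝔽 n M) C) :
    TopologicalSpace.Opens (Esp 𝔽 n M C) where
  carrier := {ζ | ∃ c ∈ Λ, NormalizedAt 𝔽 n c ζ.pt ∧ toStalk 𝔽 n ζ.pt c = ζ.val}
  is_open' := by
    refine isOpen_iff_mem_nhds.2 ?_
    rintro ζ ⟨c, hc, hn, hcζ⟩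
    obtain ⟨W, hW, hWo, hζW⟩ := mem_nhds_iff.1 hn.eventually
    refine mem_of_superset ((isOpen_basicSet (hΛ hc) hWo fun y hy => hW hy).mem_nhds ⟨hζW, hcζ⟩) ?_
    rintro ξ ⟨h1, h2⟩
    exact ⟨c, hc, hW h1, h2⟩

/-- The restriction of `Ψ_C` to the functions on the subsheaf determined by `Λ`. -/
def PsiSub (Λ : Set C) (hΛ : Λ ⊆ weaklyGrouplike (Cc 𝔽 n M) C) :
    CcSec 𝔽 n (EspSub 𝔽 n M Λ hΛ) →+ C :=
  (Psi 𝔽 n M C).comp (incPlus 𝔽 n (EspSub 𝔽 n M Λ hΛ))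

/-- `Λ` normally generates `C`: every element of `C` is a finite sum of `fᵢ cᵢ`, where `cᵢ ∈ Λ` is
normalized on the support of `fᵢ`. -/
def NormallyGenerates (Λ : Set C) : Prop :=
  ∀ c : C, ∃ (k : ℕ) (f : Fin k → Cc 𝔽 n M) (d : Fin k → C),
    (∀ i, d i ∈ Λ) ∧ (∀ i, NormalizedOn 𝔽 n (d i) (tsupport (f i).1)) ∧ c = ∑ i, f i • d i

/-- `Λ` is normally linearly independent at `x`. -/
def NormallyLinearIndependentAt (Λ : Set C) (x : M) : Prop :=
  ∀ (k : ℕ) (d : Fin k → C) (f : Fin k → Cc 𝔽 n M),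
    (∀ i, d i ∈ Λ) → (∀ i, NormalizedAt 𝔽 n (d i) x) → ∑ i, f i • d i = 0 →
    (∀ i, (f i).1 =ᶠ[𝓝 x] 0) ∨
      ∃ i j, i ≠ j ∧ ∃ g : Cc 𝔽 n M, g.1 =ᶠ[𝓝 x] 1 ∧ g • d i = g • d j

/-- `Λ` is normally linearly independent if it is so at every point. -/
def NormallyLinearIndependent (Λ : Set C) : Prop :=
  ∀ x : M, NormallyLinearIndependentAt 𝔽 n M Λ x

end Counit

end SheafCoalg

end

open scoped Manifold ContDiff Topology TensorProduct
open Filter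

noncomputable section

namespace SheafCoalg

/-! ### Extension by zero from an open subset. -/

section ExtensionByZero

variable {𝔽 : Type*} [RCLike 𝔽] {n : ℕ} {E : Type*} [TopologicalSpace E]
  [ChartedSpace (EuclideanSpace ℝ (Fin n)) E]

/-! Everything rests on a formula on stalks, `psiRel_local`: at each `x` there are finitely many
coefficients `F ζ`, indexed by grouplike `ζ` in `C_x`, such that `(Ψ u)_x = ∑ F ζ • ζ` and the germ
of `u` at the point `ζ` is the pullback of `F ζ`. Moreover an element of `C` is determined by its
stalks (`eq_of_toStalk`).

Surjectivity: the image of `Ψ_C^Λ` is the subgroup generated by the products `f • d` with `d ∈ Λ`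
normalized on the support of `f` (`range_PsiSub`). Each such product is the value of `Ψ_C^Λ` at `f ∘
π|_{d_W}`. Conversely, cutting off with bump functions reduces to sections `u` vanishing outside one
`d_W` with `d ∈ Λ`. Then every stalk of `Ψ u` is a multiple of that of `d`, and since `d` has counit
germ `1` on `W`, the multiplier is the counit of `Ψ u` itself (`Psi_eq_counit_smul`).

Injectivity: a relation `∑ f i • d i = 0` whose classes at `x` are pairwise distinct can be cut off
near `x` and lifted to an element of the kernel; its germs at the distinct points `(d i)_x` are the
germs of the `f i`. Conversely, for `u` in the kernel the stalk formula is a relation between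
distinct grouplike elements represented in `Λ`. It lifts to a relation in `C` after multiplication
by a function with germ `1`, so independence kills every coefficient
(`NormallyLinearIndependentAt.eventuallyEq_zero`). -/

theorem pushGerm_injective {O : TopologicalSpace.Opens E} (y : O) :
    Function.Injective (pushGerm y : Germ (𝓝 y) 𝔽 → Germ (𝓝 (y : E)) 𝔽) := by
  intro a b h
  induction a using Germ.inductionOn with | _ f
  induction b using Germ.inductionOn with | _ g
  have h' : (Function.extend Subtype.val f 0 : E → 𝔽) =ᶠ[𝓝 (y : E)]
      Function.extend Subtype.val g 0 := Germ.coe_eq.1 h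
  refine Germ.coe_eq.2 ?_
  filter_upwards [continuous_subtype_val.continuousAt.eventually h'] with z hz
  rwa [Subtype.val_injective.extend_apply, Subtype.val_injective.extend_apply] at hz

theorem extendSec_apply_of_mem {O : TopologicalSpace.Opens E} (u : GermSec 𝔽 O) (y : O) :
    extendSec O u y.1 = pushGerm y (u y) := by
  rw [extendSec_apply, dif_pos y.2]

theorem extendSec_apply_of_notMem {O : TopologicalSpace.Opens E} (u : GermSec 𝔽 O) {z : E}
    (hz : z ∉ O) : extendSec O u z = 0 := by
  rw [extendSec_apply, dif_neg hz]

theorem incPlus_injective (O : TopologicalSpace.Opens E) :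
    Function.Injective (incPlus 𝔽 n O) := by
  intro u v h
  refine Subtype.ext (funext fun y => pushGerm_injective y ?_)
  rw [← extendSec_apply_of_mem, ← extendSec_apply_of_mem]
  exact congrFun (congrArg Subtype.val h) y.1

/-- The support need not be closed in the non-Hausdorff space `E`. Inside `U` its complement is a
neighbourhood of the point; outside `U` the germ is zero by definition, whatever the function does
nearby. -/
theorem extendByZero_apply_of_notMem_tsupport {U : TopologicalSpace.Opens E} (f : Cc 𝔽 n U)
    {y : E} (hy : ∀ h : y ∈ U, (⟨y, h⟩ : U) ∉ tsupport f.1) : extendByZero U f y = 0 := by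
  by_cases h : y ∈ U
  · simp only [extendByZero, if_pos h]
    refine (Germ.coe_eq.2 ?_ : _ = ((0 : E → 𝔽) : Germ (𝓝 y) 𝔽))
    have h1 : f.1 =ᶠ[𝓝 ⟨y, h⟩] 0 := notMem_tsupport_iff_eventuallyEq.1 (hy h)
    have h2 := U.isOpen.isOpenEmbedding_subtypeVal.map_nhds_eq ⟨y, h⟩
    change _ =ᶠ[𝓝 ((⟨y, h⟩ : U) : E)] _
    rw [← h2]
    refine eventually_map.2 ?_
    filter_upwards [h1] with z hz
    exact (extend_apply_of_mem f.1 z.2).trans hz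
  · simp only [extendByZero, if_neg h]

end ExtensionByZero

section Range

variable {𝔽 : Type*} [RCLike 𝔽] {n : ℕ} {M : Type*} [TopologicalSpace M]
  [ChartedSpace (EuclideanSpace ℝ (Fin n)) M] [IsManifold (𝓡 n) ∞ M] [T2Space M]
  {C : Type*} [AddCommGroup C] [NUModule (Cc 𝔽 n M) C] [Coalg (Cc 𝔽 n M) C]

/-! ### Stalks of `Ψ u` and the counit. -/

theorem toStalk_nu_smul {x : M} (f : Cc 𝔽 n M) (c : C) :
    toStalk 𝔽 n x (f • c) = ofR f • toStalk 𝔽 n x c := by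
  rw [← ofR_smul, toStalk_smul]

theorem smul_toStalk_congr {x : M} {f g : Cc 𝔽 n M} (h : f.1 =ᶠ[𝓝 x] g.1) (s : Stalk 𝔽 n x C) :
    ofR f • s = ofR g • s := by
  have h0 : ofR (f - g) • s = 0 := by
    refine smul_toStalk_zero ?_ s
    filter_upwards [h] with y hy
    change f.1 y - g.1 y = 0
    rw [hy, sub_self]
  have h1 : ofR (f - g) = ofR f - ofR g := Unitization.inr_sub ℤ f g
  rwa [h1, sub_smul, sub_eq_zero] at h0

/-- A germ pulled back along the projection of the spectral sheaf vanishes iff the germ does. -/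
theorem germ_comp_pt_eq_zero {ζ : Esp 𝔽 n M C} {f : M → 𝔽} :
    ((fun ξ : Esp 𝔽 n M C => f ξ.pt) : Germ (𝓝 ζ) 𝔽) = 0 ↔ f =ᶠ[𝓝 ζ.pt] 0 := by
  -- A local homeomorphism pushes the neighbourhood filter of a point onto that of its image, so
  -- pulling back germs loses nothing.
  have h : map (Esp.pt : Esp 𝔽 n M C → M) (𝓝 ζ) = 𝓝 ζ.pt := isLocalHomeomorph_pt.map_nhds_eq _
  rw [← h]
  exact Germ.coe_eq (f := fun ξ : Esp 𝔽 n M C => f ξ.pt) (g := fun _ => 0)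

theorem eq_of_toStalk {c d : C} (h : ∀ x : M, toStalk 𝔽 n x c = toStalk 𝔽 n x d) : c = d := by
  rw [← sub_eq_zero]
  refine eq_zero_of_toStalk (𝔽 := 𝔽) (n := n) (M := M) fun x => ?_
  exact (map_sub (Nx 𝔽 n x C).mkQ c d).trans (sub_eq_zero.2 (h x))

theorem isOpen_setOf_normalizedAt (c : C) : IsOpen {x : M | NormalizedAt 𝔽 n c x} :=
  isOpen_iff_mem_nhds.2 fun _ hx => hx.eventually

theorem Psi_mem_psiRel (u : CcSec 𝔽 n (Esp 𝔽 n M C)) : (u.1, Psi 𝔽 n M C u) ∈ psiRel 𝔽 n M C :=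
  (psiRel_exists u.2).choose_spec

/-- The stalk of `Ψ u` at `x` is determined by the values of `u` on the fibre over `x`. -/
theorem toStalk_Psi_of_eq_zero {u : CcSec 𝔽 n (Esp 𝔽 n M C)} {x : M}
    (h : ∀ ζ : Esp 𝔽 n M C, ζ.pt = x → u.1 ζ = 0) : toStalk 𝔽 n x (Psi 𝔽 n M C u) = 0 := by
  obtain ⟨F, hF1, hF2⟩ := psiRel_local (Psi_mem_psiRel u) x
  rw [show toStalk 𝔽 n x (Psi 𝔽 n M C u) = _ from hF1]
  exact Finset.sum_eq_zero fun ζ _ => smul_toStalk_zero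
    (germ_comp_pt_eq_zero.1 ((hF2 ζ).symm.trans (h _ rfl))) _

/-- In the finite expansion of the stalk, a coefficient whose germ vanishes contributes nothing, so
only the term at `ζ₀` survives. -/
theorem toStalk_Psi_of_supported {u : CcSec 𝔽 n (Esp 𝔽 n M C)} {x : M} (ζ₀ : grouplike 𝔽 n C x)
    (h : ∀ ζ : grouplike 𝔽 n C x, ζ ≠ ζ₀ → u.1 ⟨x, ζ.1, ζ.2⟩ = 0) :
    ∃ f : Cc 𝔽 n M, toStalk 𝔽 n x (Psi 𝔽 n M C u) = ofR f • ζ₀.1 := by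
  obtain ⟨F, hF1, hF2⟩ := psiRel_local (Psi_mem_psiRel u) x
  refine ⟨F ζ₀, hF1.trans (Finsupp.sum_eq_single ζ₀ (fun ζ _ hne => ?_) fun _ => ?_)⟩
  · exact smul_toStalk_zero (germ_comp_pt_eq_zero.1 ((hF2 ζ).symm.trans (h ζ hne))) _
  · exact smul_toStalk_zero EventuallyEq.rfl _

theorem counit_eventuallyEq_zero {d : C} {x : M} (h : toStalk 𝔽 n x d = 0) :
    (Coalg.counit (R := Cc 𝔽 n M) d).1 =ᶠ[𝓝 x] 0 := by
  have h1 : counitAt 𝔽 n C x (toStalk 𝔽 n x d) = 0 := by rw [h, map_zero]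
  exact Germ.coe_eq.1 h1

/-- The local counit is linear and takes the value `1` on the class of `c`, so it reads off the
coefficient `f`. This makes locally chosen coefficients fit together into one global function. -/
theorem counit_eventuallyEq {c d : C} {x : M} {f : Cc 𝔽 n M} (hc : NormalizedAt 𝔽 n c x)
    (h : toStalk 𝔽 n x d = ofR f • toStalk 𝔽 n x c) :
    (Coalg.counit (R := Cc 𝔽 n M) d).1 =ᶠ[𝓝 x] f.1 := by
  have h1 : counitAt 𝔽 n C x (toStalk 𝔽 n x d) =
      counitAt 𝔽 n C x (ofR f • toStalk 𝔽 n x c) := by rw [h]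
  rw [map_smul, ofR_smul] at h1
  have h2 : counitAt 𝔽 n C x (toStalk 𝔽 n x c) = 1 := Germ.coe_eq.2 hc
  rw [h2] at h1
  refine Germ.coe_eq.1 (h1.trans ?_)
  exact mul_one (f.1 : Germ (𝓝 x) 𝔽)

/-- If `u` vanishes outside `c_W`, then `Ψ u` is the multiple of `c` by its own counit. -/
theorem Psi_eq_counit_smul {c : C} (hc : c ∈ weaklyGrouplike (Cc 𝔽 n M) C) {W : Set M}
    (hcW : NormalizedOn 𝔽 n c W) {u : CcSec 𝔽 n (Esp 𝔽 n M C)}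
    (hu : ∀ ζ, ζ ∉ basicSet c W → u.1 ζ = 0) :
    tsupport (Coalg.counit (R := Cc 𝔽 n M) (Psi 𝔽 n M C u)).1 ⊆ W ∧
      Psi 𝔽 n M C u = (Coalg.counit (R := Cc 𝔽 n M) (Psi 𝔽 n M C u)) • c := by
  -- Over a point outside `W` the fibre does not meet `c_W`, so `u` vanishes on all of it.
  have hout : ∀ x, x ∉ W → toStalk 𝔽 n x (Psi 𝔽 n M C u) = 0 := fun x hx =>
    toStalk_Psi_of_eq_zero fun ζ hζ => hu ζ fun h => hx (hζ ▸ h.1)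
  refine ⟨fun x hx => ?_, ?_⟩
  · by_contra hxW
    exact notMem_tsupport_iff_eventuallyEq.2 (counit_eventuallyEq_zero (hout x hxW)) hx
  · refine eq_of_toStalk (𝔽 := 𝔽) (n := n) (M := M) fun x => ?_
    refine Eq.trans ?_ (toStalk_nu_smul _ c).symm
    by_cases hx : x ∈ W
    · obtain ⟨f, hf⟩ := toStalk_Psi_of_supported (u := u)
        ⟨toStalk 𝔽 n x c, toStalk_mem_grouplike hc (hcW x hx)⟩
        fun ζ hne => hu _ fun h => hne (Subtype.ext h.2.symm)
      exact hf.trans (smul_toStalk_congr (counit_eventuallyEq (hcW x hx) hf).symm _)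
    · exact (hout x hx).trans
        (smul_toStalk_zero (counit_eventuallyEq_zero (hout x hx)) _).symm

/-! ### Lifting the basic functions to an open subsheaf. -/

/-- A function `f ∘ π|_{c_W}` is the extension by zero of a function on any open set
containing `c_W`. -/
theorem exists_extendSec_eq_basicFun {c : C} (hc : c ∈ weaklyGrouplike (Cc 𝔽 n M) C) {W : Set M}
    (hW : IsOpen W) (hcW : NormalizedOn 𝔽 n c W) (f : Cc 𝔽 n M) (hf : tsupport f.1 ⊆ W)
    (O : TopologicalSpace.Opens (Esp 𝔽 n M C)) (hO : basicSet c W ⊆ (O : Set (Esp 𝔽 n M C))) :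
    ∃ v ∈ CcSec 𝔽 n O, extendSec O v = basicFun c W f := by
  let U : TopologicalSpace.Opens O := ⟨Subtype.val ⁻¹' basicSet c W,
    (isOpen_basicSet hc hW hcW).preimage continuous_subtype_val⟩
  have hval : Continuous fun ζ : U => ζ.1.1 :=
    continuous_subtype_val.comp continuous_subtype_val
  -- The projection is injective on `c_W`, which therefore inherits the Hausdorff property from `M`.
  have hT : T2Space U := T2Space.of_injective_continuous (f := fun ζ : U => ζ.1.1.pt)
    (fun a b hab => Subtype.ext (Subtype.ext (injOn_pt c W a.2 b.2 hab)))
    (continuous_pt.comp hval)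
  let σ : W → U := fun x => ⟨⟨basicSection hc hcW x, hO ⟨x.2, rfl⟩⟩, x.2, rfl⟩
  have hσ : Continuous σ := ((continuous_basicSection hc hcW).subtype_mk _).subtype_mk _
  let g : Cc 𝔽 n U := ⟨fun ζ => f.1 ζ.1.1.pt, by
    intro ζ
    rw [contMDiffAt_subtype_iff (f := fun ξ : O => f.1 ξ.1.pt),
      contMDiffAt_subtype_iff (f := fun ξ : Esp 𝔽 n M C => f.1 ξ.pt)]
    exact (etale_contMDiffAt_iff isLocalHomeomorph_pt).2 ⟨f.1, f.2.1 _, EventuallyEq.rfl⟩, by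
    have hK : IsCompact ((Subtype.val : W → M) ⁻¹' tsupport f.1) :=
      (Topology.IsInducing.subtypeVal.isCompact_preimage_iff (by simpa using hf)).2 f.2.2
    -- The compact set is the image of the support of `f` under the section `x ↦ c_x`.
    refine HasCompactSupport.intro (hK.image hσ) ?_
    intro ζ hζ
    by_contra hne
    refine hζ ⟨⟨ζ.1.1.pt, ζ.2.1⟩, subset_tsupport _ hne, ?_⟩
    exact Subtype.ext (Subtype.ext (basicSection_of_mem hc hcW ζ.2))⟩
  refine ⟨extendByZero U g, AddSubgroup.subset_closure ⟨U, hT, g, rfl⟩, ?_⟩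
  funext ζ
  by_cases hζ : ζ ∈ basicSet c W
  · have hζU : (⟨ζ, hO hζ⟩ : O) ∈ U := hζ
    rw [extendSec_apply_of_mem (extendByZero U g) ⟨ζ, hO hζ⟩]
    simp only [basicFun, extendByZero, if_pos hζ, if_pos hζU]
    refine Germ.coe_eq.2 ?_
    filter_upwards [(isOpen_basicSet hc hW hcW).mem_nhds hζ] with ξ hξ
    rw [extend_apply_of_mem _ (show ξ ∈ O from hO hξ),
      extend_apply_of_mem g.1 (show (⟨ξ, hO hξ⟩ : O) ∈ U from hξ)]
  · simp only [basicFun, if_neg hζ]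
    by_cases hζO : ζ ∈ O
    · have hζU : (⟨ζ, hζO⟩ : O) ∉ U := hζ
      rw [extendSec_apply_of_mem (extendByZero U g) ⟨ζ, hζO⟩]
      simp only [extendByZero, if_neg hζU]
      exact pushGerm_zero _
    · exact extendSec_apply_of_notMem _ hζO

/-- As `c ∈ Λ` is normalized on `W`, the set `c_W` lies in the subsheaf. Both directions that need
preimages use this; `W` stays arbitrary so that several elements can share one `W`. -/
theorem exists_incPlus_eq_basicFun {Λ : Set C} (hΛ : Λ ⊆ weaklyGrouplike (Cc 𝔽 n M) C) {c : C}
    (hc : c ∈ Λ) {W : Set M} (hW : IsOpen W) (hcW : NormalizedOn 𝔽 n c W) (f : Cc 𝔽 n M)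
    (hf : tsupport f.1 ⊆ W) :
    ∃ v : CcSec 𝔽 n (EspSub 𝔽 n M Λ hΛ), (incPlus 𝔽 n _ v).1 = basicFun c W f ∧
      PsiSub 𝔽 n M Λ hΛ v = f • c := by
  obtain ⟨v, hv, hvf⟩ := exists_extendSec_eq_basicFun (hΛ hc) hW hcW f hf (EspSub 𝔽 n M Λ hΛ)
    fun ζ hζ => ⟨c, hc, hcW _ hζ.1, hζ.2⟩
  refine ⟨⟨v, hv⟩, hvf, ?_⟩
  rw [← Psi_basicFun (hΛ hc) hW hcW f hf]
  exact congrArg (Psi 𝔽 n M C) (Subtype.ext hvf)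

/-! ### The image of `Ψ_C^Λ` and normal generation. -/

variable (𝔽 n M) in
/-- The multiples `f d` of elements `d` of `Λ` which are normalized on the support of `f`. -/
def normalMultiples (Λ : Set C) : Set C :=
  {c | ∃ (f : Cc 𝔽 n M) (d : C), d ∈ Λ ∧ NormalizedOn 𝔽 n d (tsupport f.1) ∧ c = f • d}

theorem neg_mem_normalMultiples {Λ : Set C} {c : C} (hc : c ∈ normalMultiples 𝔽 n M Λ) :
    -c ∈ normalMultiples 𝔽 n M Λ := by
  obtain ⟨f, d, hd, hn, rfl⟩ := hc
  refine ⟨-f, d, hd, ?_, ?_⟩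
  · have : tsupport (-f : Cc 𝔽 n M).1 = tsupport f.1 := by
      change closure (Function.support (-f.1)) = _
      rw [Function.support_neg]
      rfl
    rwa [this]
  · exact (congrArg (fun φ : C →+ C => φ d) (map_neg (actHom (Cc 𝔽 n M) C) f)).symm

/-- The generating set is stable under negation, since the sign can be moved into `f` without
changing its support. Hence the subgroup it generates consists of plain finite sums. -/
theorem normallyGenerates_iff {Λ : Set C} :
    NormallyGenerates 𝔽 n M Λ ↔ AddSubgroup.closure (normalMultiples 𝔽 n M Λ) = ⊤ := by
  rw [AddSubgroup.eq_top_iff']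
  constructor
  · intro h c
    obtain ⟨k, f, d, hd, hn, rfl⟩ := h c
    exact sum_mem fun i _ => AddSubgroup.subset_closure ⟨f i, d i, hd i, hn i, rfl⟩
  · intro h c
    induction h c using AddSubgroup.closure_induction'' with
    | mem c hc =>
      obtain ⟨f, d, hd, hn, rfl⟩ := hc
      exact ⟨1, fun _ => f, fun _ => d, fun _ => hd, fun _ => hn, by simp⟩
    | neg_mem c hc =>
      obtain ⟨f, d, hd, hn, hfd⟩ := neg_mem_normalMultiples hc
      exact ⟨1, fun _ => f, fun _ => d, fun _ => hd, fun _ => hn, by simpa using hfd⟩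
    | zero => exact ⟨0, Fin.elim0, Fin.elim0, fun i => i.elim0, fun i => i.elim0, by simp⟩
    | add a b _ _ ha hb =>
      obtain ⟨k, f, d, hd, hn, rfl⟩ := ha
      obtain ⟨l, g, e, he, hm, rfl⟩ := hb
      refine ⟨k + l, Fin.append f g, Fin.append d e, fun i => ?_, fun i => ?_, ?_⟩
      · induction i using Fin.addCases <;> simp [hd, he]
      · induction i using Fin.addCases with
        | left i => simpa using hn i
        | right i => simpa using hm i
      · simp [Fin.sum_univ_add]

/-- The image of `Ψ_C^Λ` is generated by the multiples `f d` of elements `d` of `Λ` which are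
normalized on the support of `f`. -/
theorem range_PsiSub {Λ : Set C} (hΛ : Λ ⊆ weaklyGrouplike (Cc 𝔽 n M) C) :
    (PsiSub 𝔽 n M Λ hΛ).range = AddSubgroup.closure (normalMultiples 𝔽 n M Λ) := by
  refine le_antisymm ?_ ((AddSubgroup.closure_le _).2 ?_)
  · set S := AddSubgroup.closure (normalMultiples 𝔽 n M Λ)
    -- Stating the claim as an inclusion between subgroups of germ sections lets it be checked on
    -- the generators `extendByZero U h`, and there by `Cc.induction` for `h` supported near a
    -- point.
    suffices h : CcSec 𝔽 n (EspSub 𝔽 n M Λ hΛ) ≤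
        (S.comap (PsiSub 𝔽 n M Λ hΛ)).map (CcSec 𝔽 n (EspSub 𝔽 n M Λ hΛ)).subtype by
      rintro _ ⟨u, rfl⟩
      obtain ⟨v, hv, hvu⟩ := h u.2
      rwa [show v = u from Subtype.ext hvu] at hv
    refine (AddSubgroup.closure_le _).2 ?_
    rintro _ ⟨U, hU, h, rfl⟩
    refine Cc.induction (fun h : Cc 𝔽 n U => extendByZero U h ∈
      (S.comap (PsiSub 𝔽 n M Λ hΛ)).map (CcSec 𝔽 n (EspSub 𝔽 n M Λ hΛ)).subtype) ?_ ?_ ?_ h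
    · rw [extendByZero_zero]
      exact zero_mem _
    · intro f g hf hg
      rw [extendByZero_add]
      exact add_mem hf hg
    · intro y
      -- A point of the subsheaf is the class of some `c ∈ Λ`. The neighbourhood is the trace on `U`
      -- of `c_W`, where `W` is the whole open locus on which `c` is normalized.
      obtain ⟨c, hc, hn, hcy⟩ := y.1.2
      have ho : IsOpen (basicSet c {x | NormalizedAt 𝔽 n c x} : Set (Esp 𝔽 n M C)) :=
        isOpen_basicSet (hΛ hc) (isOpen_setOf_normalizedAt c) fun x hx => hx
      refine ⟨_, (ho.preimage (continuous_subtype_val.comp continuous_subtype_val)).mem_nhds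
        (⟨hn, hcy⟩ : y.1.1 ∈ basicSet c {x | NormalizedAt 𝔽 n c x}), fun f hf => ?_⟩
      refine ⟨⟨extendByZero U f, AddSubgroup.subset_closure ⟨U, hU, f, rfl⟩⟩, ?_, rfl⟩
      obtain ⟨h1, h2⟩ := Psi_eq_counit_smul (hΛ hc) (W := {x | NormalizedAt 𝔽 n c x})
        (fun x hx => hx) (u := incPlus 𝔽 n _
          ⟨extendByZero U f, AddSubgroup.subset_closure ⟨U, hU, f, rfl⟩⟩) (by
        intro ζ hζ
        by_cases hζO : ζ ∈ EspSub 𝔽 n M Λ hΛ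
        · refine (extendSec_apply_of_mem (extendByZero U f) ⟨ζ, hζO⟩).trans ?_
          rw [extendByZero_apply_of_notMem_tsupport f (y := ⟨ζ, hζO⟩) fun h h' => hζ (hf h'),
            pushGerm_zero]
        · exact extendSec_apply_of_notMem _ hζO)
      exact AddSubgroup.subset_closure ⟨_, c, hc, h1, h2⟩
  · rintro _ ⟨f, d, hd, hn, rfl⟩
    -- With `W` the normalization locus of `d`, the condition that the support of `f` lies in `W` is
    -- exactly `hn`.
    obtain ⟨v, -, hv⟩ := exists_incPlus_eq_basicFun hΛ hd (isOpen_setOf_normalizedAt d)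
      (fun x hx => hx) f hn
    exact ⟨v, hv⟩

theorem surjective_PsiSub_iff {Λ : Set C} (hΛ : Λ ⊆ weaklyGrouplike (Cc 𝔽 n M) C) :
    Function.Surjective (PsiSub 𝔽 n M Λ hΛ) ↔ NormallyGenerates 𝔽 n M Λ := by
  rw [normallyGenerates_iff, ← range_PsiSub hΛ, AddMonoidHom.range_eq_top]

/-! ### Injectivity and normal linear independence. -/

theorem normallyLinearIndependent_of_injective {Λ : Set C}
    (hΛ : Λ ⊆ weaklyGrouplike (Cc 𝔽 n M) C) (hinj : Function.Injective (PsiSub 𝔽 n M Λ hΛ)) :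
    NormallyLinearIndependent 𝔽 n M Λ := by
  intro x k d f hd hn hsum
  refine or_iff_not_imp_right.2 fun hne => ?_
  -- Equal classes at `x` are precisely what the excluded second alternative provides.
  have hdist : ∀ i j, i ≠ j → toStalk 𝔽 n x (d i) ≠ toStalk 𝔽 n x (d j) := by
    intro i j hij h
    rw [← sub_eq_zero, ← map_sub] at h
    obtain ⟨g, hg, hg0⟩ := toStalk_eq_zero.1 h
    rw [smul_sub, sub_eq_zero, ofR_smul, ofR_smul] at hg0
    exact hne ⟨i, j, hij, g, hg, hg0⟩
  let W : Set M := ⋂ i, {y | NormalizedAt 𝔽 n (d i) y}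
  have hW : IsOpen W := isOpen_iInter_of_finite fun i => isOpen_setOf_normalizedAt (d i)
  have hxW : x ∈ W := Set.mem_iInter.2 hn
  -- The `d i` are only known to be normalized near `x`, while the `f i` may have large supports.
  -- Multiplying by `p` shrinks the supports into `W` and keeps the germs at `x`.
  obtain ⟨p, hp1, hpW⟩ := exists_bump (𝔽 := 𝔽) (n := n) (hW.mem_nhds hxW)
  have hdW : ∀ i, NormalizedOn 𝔽 n (d i) W := fun i y hy => Set.mem_iInter.1 hy i
  choose v hv1 hv2 using fun i => exists_incPlus_eq_basicFun hΛ (hd i) hW (hdW i) (p * f i)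
    ((tsupport_mul_subset_left (f := p.1) (g := (f i).1)).trans hpW)
  have hv0 : ∑ i, v i = 0 := by
    refine hinj ?_
    rw [map_sum, map_zero]
    simp only [hv2, NUModule.mul_smul']
    have h := map_sum (actHom (Cc 𝔽 n M) C p) (fun i => f i • d i) Finset.univ
    rw [hsum, map_zero] at h
    exact h.symm
  have hB : ∑ i, basicFun (d i) W (p * f i) = (0 : GermSec 𝔽 (Esp 𝔽 n M C)) := by
    have h := congrArg (fun w => (CcSec 𝔽 n (Esp 𝔽 n M C)).subtype
      (incPlus 𝔽 n (EspSub 𝔽 n M Λ hΛ) w)) hv0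
    simp only [map_sum, map_zero] at h
    rw [← h]
    exact Finset.sum_congr rfl fun i _ => (hv1 i).symm
  intro i
  -- At this point of the fibre the summands with `j ≠ i` vanish by `hdist`, which isolates the germ
  -- of `p * f i`.
  let ζ : Esp 𝔽 n M C := ⟨x, toStalk 𝔽 n x (d i), toStalk_mem_grouplike (hΛ (hd i)) (hn i)⟩
  have hζ := congrFun hB ζ
  rw [Finset.sum_apply, Finset.sum_eq_single i] at hζ
  · rw [basicFun, if_pos ⟨hxW, rfl⟩] at hζ
    have h0 : (p * f i : Cc 𝔽 n M).1 =ᶠ[𝓝 x] 0 := germ_comp_pt_eq_zero.1 hζ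
    filter_upwards [h0, hp1] with y h1 h2
    rwa [Cc.mul_apply, h2, Pi.one_apply, one_mul] at h1
  · intro j _ hji
    exact if_neg fun h => hdist j i hji h.2
  · intro h
    exact absurd (Finset.mem_univ i) h

/-- Independence is stated for relations in `C`, whereas the kernel of `Ψ` yields relations in
`C_x`. Multiplying by some `p` with germ `1` at `x` turns the latter into the former, and distinct
classes exclude the second alternative. -/
theorem NormallyLinearIndependentAt.eventuallyEq_zero {Λ : Set C} {x : M}
    (h : NormallyLinearIndependentAt 𝔽 n M Λ x) {ι : Type*} (s : Finset ι) (d : ι → C)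
    (f : ι → Cc 𝔽 n M) (hd : ∀ i ∈ s, d i ∈ Λ) (hn : ∀ i ∈ s, NormalizedAt 𝔽 n (d i) x)
    (hdist : Set.InjOn (fun i => toStalk 𝔽 n x (d i)) s)
    (hsum : ∑ i ∈ s, ofR (f i) • toStalk 𝔽 n x (d i) = 0) :
    ∀ i ∈ s, (f i).1 =ᶠ[𝓝 x] 0 := by
  simp only [← toStalk_nu_smul, ← map_sum] at hsum
  obtain ⟨p, hp, hp0⟩ := toStalk_eq_zero.1 hsum
  -- Reindexing by `Fin` matches the form of the hypothesis `h`.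
  let e := s.equivFin.symm
  have hz : ∑ j, (p * f (e j)) • d (e j) = 0 := by
    rw [Equiv.sum_comp e fun i : s => (p * f i) • d i,
      Finset.sum_coe_sort s fun i => (p * f i) • d i, ← hp0, Finset.smul_sum]
    exact Finset.sum_congr rfl fun i _ => by rw [NUModule.mul_smul', ofR_smul]
  rcases h _ (fun j => d (e j)) (fun j => p * f (e j)) (fun j => hd _ (e j).2)
    (fun j => hn _ (e j).2) hz with h0 | ⟨i, j, hij, g, hg, hgd⟩
  · intro i hi
    have h1 := h0 (e.symm ⟨i, hi⟩)
    rw [Equiv.apply_symm_apply] at h1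
    filter_upwards [h1, hp] with y h2 h3
    rwa [Cc.mul_apply, h3, Pi.one_apply, one_mul] at h2
  · refine absurd (e.injective (Subtype.ext (hdist (e i).2 (e j).2 ?_))) hij
    change toStalk 𝔽 n x (d (e i)) = toStalk 𝔽 n x (d (e j))
    rw [← sub_eq_zero, ← map_sub]
    exact toStalk_eq_zero.2 ⟨g, hg, by rw [smul_sub, ofR_smul, ofR_smul, hgd, sub_self]⟩

theorem injective_of_normallyLinearIndependent {Λ : Set C}
    (hΛ : Λ ⊆ weaklyGrouplike (Cc 𝔽 n M) C) (h : NormallyLinearIndependent 𝔽 n M Λ) :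
    Function.Injective (PsiSub 𝔽 n M Λ hΛ) := by
  classical
  -- It suffices that the extension of `u` to the whole spectral sheaf vanishes, and the stalk
  -- formula is available there.
  refine (injective_iff_map_eq_zero _).2 fun u hu => incPlus_injective _ ?_
  rw [map_zero]
  set w := incPlus 𝔽 n (EspSub 𝔽 n M Λ hΛ) u
  have hw0 : Psi 𝔽 n M C w = 0 := hu
  have hout : ∀ ζ, ζ ∉ EspSub 𝔽 n M Λ hΛ → w.1 ζ = 0 := fun ζ hζ =>
    extendSec_apply_of_notMem _ hζ
  refine Subtype.ext (funext fun ξ => ?_)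
  obtain ⟨x, v, hv⟩ := ξ
  change w.1 _ = 0
  by_cases hmem : (⟨x, v, hv⟩ : Esp 𝔽 n M C) ∈ EspSub 𝔽 n M Λ hΛ
  swap
  · exact hout _ hmem
  obtain ⟨F, hF1, hF2⟩ := psiRel_local (Psi_mem_psiRel w) x
  refine (hF2 ⟨v, hv⟩).trans (germ_comp_pt_eq_zero.2 ?_)
  -- `P` singles out the points of the fibre lying in the subsheaf, and `d` picks representatives in
  -- `Λ`; its value `0` elsewhere is never used.
  let P : grouplike 𝔽 n C x → Prop := fun ζ => ∃ c ∈ Λ, NormalizedAt 𝔽 n c x ∧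
    toStalk 𝔽 n x c = ζ.1
  let d : grouplike 𝔽 n C x → C := fun ζ => if hζ : P ζ then hζ.choose else 0
  have hd : ∀ ζ, P ζ → d ζ ∈ Λ ∧ NormalizedAt 𝔽 n (d ζ) x ∧ toStalk 𝔽 n x (d ζ) = ζ.1 := by
    intro ζ hζ
    simp only [d, dif_pos hζ]
    exact hζ.choose_spec
  by_cases hs : (⟨v, hv⟩ : grouplike 𝔽 n C x) ∈ F.support
  swap
  · rw [Finsupp.notMem_support_iff.1 hs]
    exact EventuallyEq.rfl
  -- Only the points in `P` have representatives in `Λ`. Dropping the others leaves the sum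
  -- unchanged: the section vanishes off the subsheaf, so their coefficients have zero germ.
  refine (h x).eventuallyEq_zero (F.support.filter P) d F
    (fun ζ hζ => (hd ζ (Finset.mem_filter.1 hζ).2).1)
    (fun ζ hζ => (hd ζ (Finset.mem_filter.1 hζ).2).2.1) ?_ ?_ _
    (Finset.mem_filter.2 ⟨hs, hmem⟩)
  -- The class of `d ζ` is `ζ` itself, so distinct indices have distinct classes.
  · intro ζ hζ ξ hξ hζξ
    refine Subtype.ext ?_
    rw [← (hd ζ (Finset.mem_filter.1 hζ).2).2.2, ← (hd ξ (Finset.mem_filter.1 hξ).2).2.2]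
    exact hζξ
  · have h1 : F.sum (fun ζ f => ofR f • ζ.1) = 0 := by
      rw [← hF1]
      change toStalk 𝔽 n x (Psi 𝔽 n M C w) = 0
      rw [hw0]
      exact map_zero (Nx 𝔽 n x C).mkQ
    refine Eq.trans ?_ h1
    rw [Finsupp.sum, Finset.sum_filter]
    refine Finset.sum_congr rfl fun ζ _ => ?_
    split_ifs with hζ
    · rw [(hd ζ hζ).2.2]
    · exact (smul_toStalk_zero (germ_comp_pt_eq_zero.1 ((hF2 ζ).symm.trans (hout _ hζ))) _).symm

end Range

end SheafCoalg

end

theorem theorem12 (𝔽 : Type*) [RCLike 𝔽] (n : ℕ) (M : Type*) [TopologicalSpace M]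
    [ChartedSpace (EuclideanSpace ℝ (Fin n)) M] [IsManifold (𝓡 n) ∞ M] [T2Space M]
    (C : Type*) [AddCommGroup C] [SheafCoalg.NUModule (SheafCoalg.Cc 𝔽 n M) C]
    [SheafCoalg.Coalg (SheafCoalg.Cc 𝔽 n M) C]
    (Λ : Set C) (hΛ : Λ ⊆ SheafCoalg.weaklyGrouplike (SheafCoalg.Cc 𝔽 n M) C) :
    (Function.Surjective (SheafCoalg.PsiSub 𝔽 n M Λ hΛ) ↔
      SheafCoalg.NormallyGenerates 𝔽 n M Λ) ∧
    (Function.Injective (SheafCoalg.PsiSub 𝔽 n M Λ hΛ) ↔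
      SheafCoalg.NormallyLinearIndependent 𝔽 n M Λ) :=
  ⟨SheafCoalg.surjective_PsiSub_iff hΛ, SheafCoalg.normallyLinearIndependent_of_injective hΛ,
    SheafCoalg.injective_of_normallyLinearIndependent hΛ⟩
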